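/- **Setting.** Let $\mu$ be Lebesgue measure on $[0,1]$, let $M_0\ge 1$, let $\mathcal E_0=\{0,\tfrac1{M_0},\dots,1\}$ and let $A_j=(\tfrac{j-1}{M_0},\tfrac{j}{M_0})$, $1\le j\le M_0$. Let $S:[0,1]\to[0,1]$ satisfy: (i) $S$ preserves $\mu$; (ii) $S$ is linear (affine) on each $A_j$; (iii) at every $e\in\mathcal E_0$ the one-sided limits of $S$ (from within $[0,1]$) belong to $\mathcal E_0$, and $S(e)$ is one of them; (iv) the slope of $S$ on each $A_j$ (necessarily an integer) has absolute value at least $2$. Let $L_0$ be the least common multiple of the absolute values of these slopes and, for $n\in M_0\mathbb N$, $n\geq 1$, let $\tilde K(n)$ be the largest integer $m$ with $L_0^{m}\mid n/M_0$. For such $n$ put $E_x=(\tfrac{x-1}{n},\tfrac xn)$, $1\le x\le n$, and let $P_n$ be the $n\times n$ matrix with $(P_n)_{xy}=1/|S'(z)|$ (any $z\in E_x$) if $S(E_x)\cap E_y\neq\emptyset$, and $(P_n)_{xy}=0$ otherwise. For $h:[0,1]\to\mathbb C$ integrable let $O_n(h)$ be the diagonal $n\times n$ matrix with entries $O_n(h)_{xx}=n\int_{E_x}h(z)\,dz$.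 **Theorem (quantum ergodicity in bins).** Let $S$ satisfy (i)–(iv) and be ergodic with respect to $\mu$. Let $(n_k)_k$ be a sequence of positive multiples of $M_0$ with $\tilde K(n_k)\to\infty$, and for each $k$ let $U_{n_k}$ be a unitary $n_k\times n_k$ matrix with $|(U_{n_k})_{xy}|^2=(P_{n_k})_{xy}$ for all $x,y$. Let $(\psi^{(n_k,j)})_{j=1}^{n_k}$ be any orthonormal basis of $\mathbb C^{n_k}$ consisting of eigenvectors of $U_{n_k}$, with eigenvalues $e^{i\theta^{(n_k,j)}}$. Let $I(n_k)$ be intervals in $\mathbb R/2\pi\mathbb Z$, of lengths $|I(n_k)|\in[0,2\pi]$, with $|I(n_k)|\,\tilde K(n_k)\to\infty$ as $k\to\infty$, and let $B_k=\{j:\theta^{(n_k,j)}\in I(n_k)\}$. Then $B_k\ne\emptyset$ for all sufficiently large $k$, and: 1. for every Lipschitz $h:[0,1]\to\mathbb C$, $$\frac1{\#B_k}\sum_{j\in B_k}\Big|\big\langle\psi^{(n_k,j)},O_{n_k}(h)\psi^{(n_k,j)}\big\rangle-\int_0^1h(x)\,dx\Big|^2\longrightarrow0\qquad(k\to\infty);$$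 2. consequently, there are sets $\Lambda_k\subseteq B_k$ with $\#\Lambda_k/\#B_k\to1$ such that, for every continuous $h:[0,1]\to\mathbb C$ and every sequence $(j_k)_k$ of indices $1\le j_k\le n_k$ with $j_k\in\Lambda_k$ for all sufficiently large $k$, $$\lim_{k\to\infty}\big\langle\psi^{(n_k,j_k)},O_{n_k}(h)\psi^{(n_k,j_k)}\big\rangle=\int_0^1h(x)\,dx .$$ -/

import Mathlib

open Set Filter Topology MeasureTheory

noncomputable section

namespace IntervalMap

/-- The endpoints `0, 1/M, …, 1` of the partition of `[0,1]` into `M` equal intervals. -/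
def grid (M : ℕ) : Set ℝ := {e | ∃ i : ℕ, i ≤ M ∧ e = (i : ℝ) / M}

/-- The open atoms `(x/n, (x+1)/n)`, `x = 0, …, n-1`, of the partition of `[0,1]` into `n` equal
intervals. -/
def atom (n : ℕ) (x : Fin n) : Set ℝ := Ioo ((x : ℝ) / n) (((x : ℝ) + 1) / n)

/-- The slope `S'(z)` of `S` on the atom `x` of the partition into `n` equal intervals, evaluated
at the midpoint `z` of the atom (whenever `S` is linear on the atom, any other point `z` of the
atom gives the same value). -/
def slopeOn (S : ℝ → ℝ) (n : ℕ) (x : Fin n) : ℝ := deriv S (((x : ℝ) + 1 / 2) / n)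

/-- Lebesgue measure on `[0,1]`. -/
def leb01 : Measure ℝ := volume.restrict (Icc (0 : ℝ) 1)

/-- The piecewise-linear maps `S : [0,1] → [0,1]` under consideration, with base partition into
`M₀` equal atoms. Only the values of `S` on `[0,1]` matter. -/
structure IsAdmissible (S : ℝ → ℝ) (M₀ : ℕ) : Prop where
  pos : 0 < M₀
  mapsTo : MapsTo S (Icc 0 1) (Icc 0 1)
  /-- (i) `S` preserves Lebesgue measure. -/
  measurePreserving : MeasurePreserving S leb01 leb01
  /-- (ii) `S` is linear (that is, affine) on each of the `M₀` atoms. -/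
  linear : ∀ j : Fin M₀, ∃ m c : ℝ, ∀ x ∈ atom M₀ j, S x = m * x + c
  /-- (iii) One-sided limits at endpoints of atoms are endpoints of atoms. -/
  limit_right : ∀ e ∈ grid M₀, e < 1 → ∃ l ∈ grid M₀, Tendsto S (𝓝[>] e) (𝓝 l)
  limit_left : ∀ e ∈ grid M₀, 0 < e → ∃ l ∈ grid M₀, Tendsto S (𝓝[<] e) (𝓝 l)
  /-- (iii) The value at an endpoint is one of the one-sided limits there. -/
  value : ∀ e ∈ grid M₀, (e < 1 ∧ Tendsto S (𝓝[>] e) (𝓝 (S e))) ∨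
    (0 < e ∧ Tendsto S (𝓝[<] e) (𝓝 (S e)))
  /-- (iv) The slope on each atom is at least two in absolute value. -/
  two_le_slope : ∀ j : Fin M₀, 2 ≤ |slopeOn S M₀ j|

/-- `L₀`, the least common multiple of (the absolute values of) the slopes of `S`. For an
admissible `S` every slope is an integer, so that the floor changes nothing. -/
def slopeLcm (S : ℝ → ℝ) (M₀ : ℕ) : ℕ :=
  Finset.univ.lcm fun j : Fin M₀ => ⌊|slopeOn S M₀ j|⌋₊

/-- `K̃(n)`, the exponent of the largest power of `L₀` dividing `n / M₀`. -/
def Ktilde (S : ℝ → ℝ) (M₀ n : ℕ) : ℕ := multiplicity (slopeLcm S M₀) (n / M₀)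

open Classical in
/-- The Markov transition matrix `P_n`. -/
def markovMatrix (S : ℝ → ℝ) (n : ℕ) : Matrix (Fin n) (Fin n) ℝ := fun x y =>
  if (S '' atom n x ∩ atom n y).Nonempty then 1 / |slopeOn S n x| else 0

/-- `U` is a unitary quantization of `S` in dimension `n`: it is unitary with
`|U_{xy}|² = (P_n)_{xy}`. -/
structure IsQuantization (S : ℝ → ℝ) (n : ℕ) (U : Matrix (Fin n) (Fin n) ℂ) : Prop where
  unitary : U ∈ Matrix.unitaryGroup (Fin n) ℂ
  normSq : ∀ x y, ‖U x y‖ ^ 2 = markovMatrix S n x y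

/-- The quantum observable `O_n(h)`: the diagonal matrix of the averages of `h` over the atoms. -/
def observable (n : ℕ) (h : ℝ → ℂ) : Matrix (Fin n) (Fin n) ℂ :=
  Matrix.diagonal fun x => (n : ℂ) * ∫ z in atom n x, h z

/-- The expectation value `⟨ψ, O_n(h) ψ⟩`. -/
def expectation {n : ℕ} (h : ℝ → ℂ) (ψ : EuclideanSpace ℂ (Fin n)) : ℂ :=
  inner ℂ ψ (Matrix.toEuclideanLin (observable n h) ψ)

/-- `(ψ_j)` is an orthonormal basis of eigenvectors of `U`, with eigenvalues `e^{iθ_j}`. -/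
def IsEigenbasis {n : ℕ} (U : Matrix (Fin n) (Fin n) ℂ) (θ : Fin n → ℝ)
    (ψ : OrthonormalBasis (Fin n) ℂ (EuclideanSpace ℂ (Fin n))) : Prop :=
  ∀ j, Matrix.toEuclideanLin U (ψ j) = Complex.exp (θ j * Complex.I) • ψ j

/-- `I` is an interval (open, closed or half-open) of length `len` in the circle
`ℝ / 2πℤ`. -/
def IsArc (I : Set Real.Angle) (len : ℝ) : Prop :=
  0 ≤ len ∧ len ≤ 2 * Real.pi ∧ ∃ (a : ℝ) (J : Set ℝ),
    Ioo a (a + len) ⊆ J ∧ J ⊆ Icc a (a + len) ∧ I = (fun t : ℝ => (t : Real.Angle)) '' J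

open Classical in
/-- The bin `{j : θ_j ∈ I}`. -/
def bin {n : ℕ} (θ : Fin n → ℝ) (I : Set Real.Angle) : Finset (Fin n) :=
  Finset.univ.filter fun j => (θ j : Real.Angle) ∈ I

end IntervalMap

end

open IntervalMap

/-!
The proof follows the classical scheme for quantum ergodicity, with averages over a bin in place
of averages over the whole eigenbasis.

*Eigenvalues in an arc.* The spectral measure of `U` at the coordinate `x` has Fourier
coefficients `(U ^ l) x x`. A nonzero coefficient forces the atom `x` to be contained in its image
under one of the `M₀ ^ l` compositions of branches of `S`; each of them is an expanding affine
map and has a single fixed point, so only `O(M₀ ^ l)` coordinates are affected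
(`IsQuantization.card_recurrentSet_le`). Up to the time `R = K̃ / (2 M₀)` this is `o(n / K̃)`.
At all other coordinates the spectral measure integrates trigonometric polynomials of degree at
most `R` like the uniform measure. Since `1 / |I|` is much smaller than `R`, testing against
two explicit polynomials shows that the arc `I` has mass `O(|I|)` at each such coordinate
and that it contains at least a constant times `n |I|` eigenvalues
(`IsEigenbasis.arc_bounds`). Sharp constants are not needed.

*Egorov property.* If `M₀ * L₀ ^ t` divides `n`, then `S^[t]` is affine on each atom
(`IsAdmissible.iterate_affine`). Hence `U` intertwines the observables of `g ∘ S^[t]` and of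
`g ∘ S^[t + 1]` up to `O(1 / √n)` for Lipschitz `g`, and in the expectation values of eigenvectors
`g` may be replaced by its time average of any fixed length
(`IsQuantization.norm_expectation_sub_timeAverage_le`).

*Conclusion.* By the Cauchy-Schwarz inequality the variance over the bin is at most a
constant times the mean square of the time average of `g`, up to `o(1)`
(`IsQuantization.bin_average_le`), and this mean square tends to zero by von Neumann's ergodic
theorem when `g` has mean zero (`tendsto_integral_norm_sq_birkhoff`). The sets of full density
come from Chebyshev's inequality applied to a weighted sum over all monomials
(`exists_full_density_subsets`); Weierstrass approximation extends the convergence from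
monomials to continuous observables.
-/

open IntervalMap

namespace IntervalMap

/-! ### Spectral weights and trigonometric polynomials -/

lemma moment_pair {ι : Type*} [Fintype ι] {w φ : ι → ℝ} {R : ℕ}
    (hw : ∑ j, w j = 1)
    (hm : ∀ l : ℕ, 1 ≤ l → l ≤ R → ∑ j, (w j : ℂ) * Complex.exp (φ j * Complex.I) ^ l = 0)
    {l l' : ℕ} (hl : l ≤ R) (hl' : l' ≤ R) :
    ∑ j, (w j : ℂ) * (Complex.exp (φ j * Complex.I) ^ l *
      (starRingEnd ℂ) (Complex.exp (φ j * Complex.I) ^ l')) = if l = l' then 1 else 0 := by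
  have hunit : ∀ j, Complex.exp (φ j * Complex.I) *
      (starRingEnd ℂ) (Complex.exp (φ j * Complex.I)) = 1 := by
    intro j
    rw [Complex.mul_conj, Complex.normSq_eq_norm_sq, Complex.norm_exp_ofReal_mul_I]; simp
  have key : ∀ (l l' : ℕ), l' < l → l ≤ R → ∑ j, (w j : ℂ) * (Complex.exp (φ j * Complex.I) ^ l *
      (starRingEnd ℂ) (Complex.exp (φ j * Complex.I) ^ l')) = 0 := by
    intro l l' h hl
    rw [← hm (l - l') (by omega) (by omega)]
    refine Finset.sum_congr rfl fun j _ => ?_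
    congr 1
    obtain ⟨d, rfl⟩ := Nat.exists_eq_add_of_lt h
    rw [show l' + d + 1 - l' = d + 1 by omega, show l' + d + 1 = (d + 1) + l' by ring, pow_add,
      mul_assoc, map_pow, ← mul_pow, hunit, one_pow, mul_one]
  rcases lt_trichotomy l l' with h | h | h
  · rw [if_neg h.ne, ← map_zero (starRingEnd ℂ), ← key l' l h hl', map_sum]
    refine Finset.sum_congr rfl fun j _ => ?_
    simp only [map_mul, map_pow, Complex.conj_ofReal, Complex.conj_conj]
    ring
  · subst h
    rw [if_pos rfl]
    simp only [map_pow, ← mul_pow, hunit, one_pow, mul_one]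
    exact_mod_cast hw
  · rw [if_neg h.ne', key l l' h hl]

/-- If the first `R` Fourier coefficients of the probability weights `w` at the phases `φ` vanish,
then the weights integrate products of trigonometric polynomials of degree at most `R` exactly as
the uniform measure on the circle does. -/
lemma sum_weights_mul_conj {ι : Type*} [Fintype ι] {w φ : ι → ℝ} {R N : ℕ} (hN : N ≤ R + 1)
    (hw : ∑ j, w j = 1)
    (hm : ∀ l : ℕ, 1 ≤ l → l ≤ R → ∑ j, (w j : ℂ) * Complex.exp (φ j * Complex.I) ^ l = 0)
    (a b : ℕ → ℝ) :
    ∑ j, (w j : ℂ) * ((∑ l ∈ Finset.range N, (a l : ℂ) * Complex.exp (φ j * Complex.I) ^ l) *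
      (starRingEnd ℂ) (∑ l ∈ Finset.range N, (b l : ℂ) * Complex.exp (φ j * Complex.I) ^ l)) =
      ((∑ l ∈ Finset.range N, a l * b l : ℝ) : ℂ) := by
  have h1 : ∀ j, (w j : ℂ) * ((∑ l ∈ Finset.range N, (a l : ℂ) * Complex.exp (φ j * Complex.I) ^ l) *
      (starRingEnd ℂ) (∑ l ∈ Finset.range N, (b l : ℂ) * Complex.exp (φ j * Complex.I) ^ l)) =
      ∑ l ∈ Finset.range N, ∑ l' ∈ Finset.range N, (a l * b l' : ℂ) * ((w j : ℂ) *
       (Complex.exp (φ j * Complex.I) ^ l *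
        (starRingEnd ℂ) (Complex.exp (φ j * Complex.I) ^ l'))) := by
    intro j
    rw [map_sum, Finset.sum_mul_sum, Finset.mul_sum]
    refine Finset.sum_congr rfl fun l _ => ?_
    rw [Finset.mul_sum]
    refine Finset.sum_congr rfl fun l' _ => ?_
    rw [map_mul, Complex.conj_ofReal]; ring
  simp_rw [h1]
  rw [Finset.sum_comm]
  push_cast
  refine Finset.sum_congr rfl fun l hl => ?_
  rw [Finset.sum_comm]
  rw [Finset.sum_eq_single l]
  · rw [← Finset.mul_sum, moment_pair hw hm (by grind) (by grind), if_pos rfl, mul_one]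
  · intro l' hl' hne
    rw [← Finset.mul_sum, moment_pair hw hm (by grind) (by grind), if_neg hne.symm, mul_zero]
  · intro h; exact absurd hl h

/-- Upper bound for the mass of a short arc, by comparison with the squared Dirichlet kernel
of degree `⌊1/δ⌋`. -/
lemma sum_weights_arc_le {ι : Type*} [Fintype ι] {w φ : ι → ℝ} {R : ℕ} (hw0 : ∀ j, 0 ≤ w j)
    (hw : ∑ j, w j = 1)
    (hm : ∀ l : ℕ, 1 ≤ l → l ≤ R → ∑ j, (w j : ℂ) * Complex.exp (φ j * Complex.I) ^ l = 0)
    {δ : ℝ} (hδ : 0 < δ) (hR : 1 / δ ≤ R) (B : Finset ι)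
    (hB : ∀ j ∈ B, ∃ t : ℝ, |t| ≤ δ ∧ (t : Real.Angle) = (φ j : Real.Angle)) :
    ∑ j ∈ B, w j ≤ 4 * δ := by
  set N := ⌊1 / δ⌋₊ + 1 with hNdef
  have hNR : N ≤ R + 1 := by
    have : ⌊1 / δ⌋₊ ≤ R := by
      have := Nat.floor_le_floor hR
      simpa using this
    omega
  have hfl : (⌊1 / δ⌋₊ : ℝ) * δ ≤ 1 := by
    have := Nat.floor_le (a := 1 / δ) (by positivity)
    rwa [le_div_iff₀ hδ] at this
  have hNδ : 1 ≤ N * δ := by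
    have := Nat.lt_floor_add_one (1 / δ)
    rw [div_lt_iff₀ hδ] at this
    rw [hNdef]; push_cast; exact this.le
  have hNpos : (0 : ℝ) < N := by rw [hNdef]; positivity
  have hsum := sum_weights_mul_conj hNR hw hm (fun _ => 1) (fun _ => 1)
  simp only [Complex.ofReal_one, one_mul, Complex.mul_conj, Complex.normSq_eq_norm_sq] at hsum
  have hsum' : ∑ j, w j * ‖∑ l ∈ Finset.range N, Complex.exp (φ j * Complex.I) ^ l‖ ^ 2 = N := by
    have : ((∑ j, w j * ‖∑ l ∈ Finset.range N, Complex.exp (φ j * Complex.I) ^ l‖ ^ 2 : ℝ) : ℂ)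
        = ((N : ℝ) : ℂ) := by
      push_cast at hsum ⊢
      rw [hsum]; simp
    exact_mod_cast this
  have hlow : ∀ j ∈ B, (N / 2 : ℝ) ≤ ‖∑ l ∈ Finset.range N, Complex.exp (φ j * Complex.I) ^ l‖ := by
    intro j hj
    obtain ⟨t, ht, htφ⟩ := hB j hj
    have hexp : Complex.exp (φ j * Complex.I) = Complex.exp (t * Complex.I) := by
      rw [← Circle.coe_exp, ← Circle.coe_exp, ← Real.Angle.toCircle_coe, ← Real.Angle.toCircle_coe,
        htφ]
    rw [hexp]
    refine le_trans ?_ (Complex.re_le_norm _)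
    rw [Complex.re_sum]
    have : ∀ l ∈ Finset.range N, (1 / 2 : ℝ) ≤ (Complex.exp (t * Complex.I) ^ l).re := by
      intro l hl
      rw [← Complex.exp_nat_mul, ← mul_assoc,
        show ((l : ℂ) * t * Complex.I) = ((l * t : ℝ) : ℂ) * Complex.I by push_cast; ring,
        Complex.exp_ofReal_mul_I_re]
      have hlt : |(l : ℝ) * t| ≤ 1 := by
        rw [abs_mul, Nat.abs_cast]
        refine le_trans ?_ hfl
        have : (l : ℝ) ≤ ⌊1 / δ⌋₊ := by
          have := Finset.mem_range.1 hl
          exact_mod_cast (by omega : l ≤ ⌊1 / δ⌋₊)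
        gcongr
      have := Real.one_sub_sq_div_two_le_cos (x := (l : ℝ) * t)
      have h2 := (sq_le_one_iff_abs_le_one _).2 hlt
      linarith
    calc (N / 2 : ℝ) = ∑ l ∈ Finset.range N, (1 / 2 : ℝ) := by simp; ring
      _ ≤ _ := Finset.sum_le_sum this
  have : (∑ j ∈ B, w j) * (N / 2 : ℝ) ^ 2 ≤ N := by
    calc (∑ j ∈ B, w j) * (N / 2 : ℝ) ^ 2
        = ∑ j ∈ B, w j * (N / 2 : ℝ) ^ 2 := by rw [Finset.sum_mul]
      _ ≤ ∑ j ∈ B, w j * ‖∑ l ∈ Finset.range N, Complex.exp (φ j * Complex.I) ^ l‖ ^ 2 := by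
          refine Finset.sum_le_sum fun j hj => ?_
          have := hlow j hj
          have := hw0 j
          gcongr
      _ ≤ ∑ j, w j * ‖∑ l ∈ Finset.range N, Complex.exp (φ j * Complex.I) ^ l‖ ^ 2 :=
          Finset.sum_le_sum_of_subset_of_nonneg (Finset.subset_univ _)
            (fun j _ _ => mul_nonneg (hw0 j) (by positivity))
      _ = N := hsum'
  have h3 : (∑ j ∈ B, w j) * N ≤ 4 := by
    have : (∑ j ∈ B, w j) * N * N ≤ 4 * N := by nlinarith
    exact le_of_mul_le_mul_right this hNpos
  have h4 : 0 ≤ ∑ j ∈ B, w j := Finset.sum_nonneg fun j _ => hw0 j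
  nlinarith [mul_le_mul_of_nonneg_left hNδ h4]

lemma sum_sin_mul_sin_succ {N : ℕ} (hN : N ≠ 0) :
    ∑ l ∈ Finset.range N, Real.sin (l * (Real.pi / N)) * Real.sin ((l + 1) * (Real.pi / N)) =
      Real.cos (Real.pi / N) * ∑ l ∈ Finset.range N, Real.sin (l * (Real.pi / N)) ^ 2 := by
  set x := Real.pi / N with hx
  have hNx : N * x = Real.pi := by rw [hx]; field_simp
  have h1 : ∀ l : ℕ, Real.sin (l * x) * Real.sin ((l + 1) * x) =
      Real.cos x * Real.sin (l * x) ^ 2 -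
      (Real.cos ((2 * ((l + 1 : ℕ) : ℝ) - 1) * x) - Real.cos ((2 * (l : ℝ) - 1) * x)) / 4 := by
    intro l
    rw [show (2 * ((l + 1 : ℕ) : ℝ) - 1) * x = 2 * (l * x) + x by push_cast; ring,
      show (2 * (l : ℝ) - 1) * x = 2 * (l * x) - x by ring,
      show ((l : ℝ) + 1) * x = l * x + x by ring, Real.sin_add, Real.cos_add, Real.cos_sub,
      Real.sin_two_mul]
    ring
  simp_rw [h1]
  rw [Finset.sum_sub_distrib, ← Finset.mul_sum, ← Finset.sum_div,
    Finset.sum_range_sub (fun l : ℕ => Real.cos ((2 * (l : ℝ) - 1) * x))]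
  rw [show (2 * (N : ℝ) - 1) * x = 2 * Real.pi - x by rw [← hNx]; ring, Real.cos_two_pi_sub]
  simp

/-- The trigonometric polynomial `|∑ sin(lπ/N) e^{ilφ}|² (cos φ - cos δ)` is positive only for
`|φ| < δ`; comparing its mean with its maximum bounds the mass near `φ = 0` from below. The sine
coefficients make the quotient of the first two Fourier coefficients of the square equal to
`cos (π/N)`, the largest value possible for the given degree. -/
lemma le_sum_weights_arc {ι : Type*} [Fintype ι] {w φ : ι → ℝ} {R N : ℕ} (hw0 : ∀ j, 0 ≤ w j)
    (hw : ∑ j, w j = 1)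
    (hm : ∀ l : ℕ, 1 ≤ l → l ≤ R → ∑ j, (w j : ℂ) * Complex.exp (φ j * Complex.I) ^ l = 0)
    {δ : ℝ} (hδ : 0 < δ) (hδπ : δ ≤ Real.pi) (hN : 2 * Real.pi / δ ≤ N) (hNR : N ≤ R)
    (B : Finset ι) (hB : ∀ j, Real.cos δ < Real.cos (φ j) → j ∈ B) :
    1 / (2 * N) ≤ ∑ j ∈ B, w j := by
  have hπ := Real.pi_pos
  have hNpos : (0 : ℝ) < N := lt_of_lt_of_le (by positivity) hN
  have hN0 : N ≠ 0 := by rintro rfl; simp at hNpos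
  have hN2 : 2 ≤ N := by
    have : (2 : ℝ) ≤ N := by
      refine le_trans ?_ hN
      rw [le_div_iff₀ hδ]; linarith
    exact_mod_cast this
  set x := Real.pi / N with hx
  have hNx : N * x = Real.pi := by rw [hx]; field_simp
  set a : ℕ → ℝ := fun l => Real.sin (l * x) with ha
  set b : ℕ → ℝ := fun l => if l = 0 then 0 else a (l - 1) with hb
  set P : ι → ℂ := fun j => ∑ l ∈ Finset.range (N + 1), (a l : ℂ) * Complex.exp (φ j * Complex.I) ^ l
    with hP
  have haN : a N = 0 := by simp [ha, hNx]
  have ha0 : a 0 = 0 := by simp [ha]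
  set A := ∑ l ∈ Finset.range N, a l ^ 2 with hA
  have hApos : 0 < A := by
    refine lt_of_lt_of_le ?_ (Finset.single_le_sum (f := fun l => a l ^ 2)
      (fun l _ => sq_nonneg _) (Finset.mem_range.2 (by omega : 1 < N)))
    have : 0 < a 1 := by
      simp only [ha, Nat.cast_one, one_mul]
      refine Real.sin_pos_of_pos_of_lt_pi (by positivity) ?_
      rw [hx, div_lt_iff₀ hNpos]
      have : (2 : ℝ) ≤ N := by exact_mod_cast hN2
      nlinarith
    positivity
  have hshift : ∀ j, ∑ l ∈ Finset.range (N + 1), (b l : ℂ) * Complex.exp (φ j * Complex.I) ^ l =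
      Complex.exp (φ j * Complex.I) * P j := by
    intro j
    rw [Finset.sum_range_succ', hP]
    simp only
    rw [Finset.sum_range_succ, haN]
    simp only [hb, if_true, Nat.add_sub_cancel, Nat.succ_ne_zero, if_false, Complex.ofReal_zero,
      zero_mul, add_zero, Finset.mul_sum, pow_succ]
    refine Finset.sum_congr rfl fun l _ => by ring
  have hs1 : ∑ j, w j * ‖P j‖ ^ 2 = A := by
    have := sum_weights_mul_conj (N := N + 1) (by omega) hw hm a a
    simp only [Complex.mul_conj, Complex.normSq_eq_norm_sq] at this
    have h2 : (∑ j, w j * ‖P j‖ ^ 2) = ∑ l ∈ Finset.range (N + 1), a l * a l := by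
      exact_mod_cast this
    rw [h2, Finset.sum_range_succ, haN, hA]
    simp [sq]
  have hs2 : ∑ j, w j * (‖P j‖ ^ 2 * Real.cos (φ j)) = Real.cos x * A := by
    have := sum_weights_mul_conj (N := N + 1) (by omega) hw hm a b
    simp only [hshift] at this
    have h2 := congrArg Complex.re this
    rw [Complex.ofReal_re, Finset.sum_range_succ', Complex.re_sum] at h2
    have h3 : ∑ l ∈ Finset.range N, a (l + 1) * b (l + 1) = Real.cos x * A := by
      rw [hA, ← sum_sin_mul_sin_succ hN0]
      refine Finset.sum_congr rfl fun l _ => ?_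
      simp only [hb, ha, Nat.succ_ne_zero, if_false, Nat.add_sub_cancel]
      push_cast; ring
    rw [h3, ha0, zero_mul, add_zero] at h2
    rw [← h2]
    refine Finset.sum_congr rfl fun j _ => ?_
    change _ = ((w j : ℂ) * (P j * _)).re
    rw [Complex.re_ofReal_mul, map_mul, mul_left_comm (P j), Complex.mul_conj,
      Complex.normSq_eq_norm_sq, Complex.re_mul_ofReal, Complex.conj_re,
      Complex.exp_ofReal_mul_I_re]
    ring
  have hPle : ∀ j, ‖P j‖ ^ 2 ≤ N * A := by
    intro j
    have h1 : ‖P j‖ ≤ ∑ l ∈ Finset.range N, |a l| := by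
      have : P j = ∑ l ∈ Finset.range N, (a l : ℂ) * Complex.exp (φ j * Complex.I) ^ l := by
        rw [hP]; simp only; rw [Finset.sum_range_succ, haN]; simp
      rw [this]
      refine (norm_sum_le _ _).trans (Finset.sum_le_sum fun l _ => ?_)
      rw [norm_mul, norm_pow, Complex.norm_exp_ofReal_mul_I, one_pow, mul_one, Complex.norm_real,
        Real.norm_eq_abs]
    calc ‖P j‖ ^ 2 ≤ (∑ l ∈ Finset.range N, |a l|) ^ 2 := by gcongr
      _ ≤ (Finset.range N).card * ∑ l ∈ Finset.range N, |a l| ^ 2 := sq_sum_le_card_mul_sum_sq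
      _ = N * A := by simp [hA]
  have hcos1 : Real.cos δ < 1 := by
    have := Real.cos_lt_cos_of_nonneg_of_le_pi le_rfl hδπ hδ
    simpa using this
  have hmain : (Real.cos x - Real.cos δ) * A ≤ (∑ j ∈ B, w j) * (N * A * (1 - Real.cos δ)) := by
    calc (Real.cos x - Real.cos δ) * A
        = ∑ j, w j * (‖P j‖ ^ 2 * (Real.cos (φ j) - Real.cos δ)) := by
          rw [sub_mul, ← hs2, ← hs1, Finset.mul_sum, ← Finset.sum_sub_distrib]
          exact Finset.sum_congr rfl fun j _ => by ring
      _ ≤ ∑ j ∈ B, w j * (‖P j‖ ^ 2 * (Real.cos (φ j) - Real.cos δ)) := by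
          classical
          rw [← Finset.sum_add_sum_compl B]
          have : ∑ j ∈ Bᶜ, w j * (‖P j‖ ^ 2 * (Real.cos (φ j) - Real.cos δ)) ≤ 0 := by
            refine Finset.sum_nonpos fun j hj => ?_
            have h1 : Real.cos (φ j) ≤ Real.cos δ := by
              by_contra h
              exact (Finset.mem_compl.1 hj) (hB j (not_le.1 h))
            exact mul_nonpos_of_nonneg_of_nonpos (hw0 j)
              (mul_nonpos_of_nonneg_of_nonpos (by positivity) (by linarith))
          linarith
      _ ≤ ∑ j ∈ B, w j * (N * A * (1 - Real.cos δ)) := by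
          refine Finset.sum_le_sum fun j _ => mul_le_mul_of_nonneg_left ?_ (hw0 j)
          calc ‖P j‖ ^ 2 * (Real.cos (φ j) - Real.cos δ) ≤ ‖P j‖ ^ 2 * (1 - Real.cos δ) := by
                gcongr; exact Real.cos_le_one _
            _ ≤ _ := by
                have : 0 ≤ 1 - Real.cos δ := by linarith
                gcongr; exact hPle j
      _ = _ := by rw [Finset.sum_mul]
  have hx2 : Real.cos (δ / 2) ≤ Real.cos x := by
    refine Real.cos_le_cos_of_nonneg_of_le_pi (by positivity) (by linarith) ?_
    rw [hx, div_le_iff₀ hNpos]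
    rw [div_le_iff₀ hδ] at hN
    linarith
  -- half-angle comparison: `cos (δ/2) - cos δ` is at least half of `1 - cos δ`
  have hhalf : (1 - Real.cos δ) / 2 ≤ Real.cos x - Real.cos δ := by
    have h1 : Real.cos δ = 2 * Real.cos (δ / 2) ^ 2 - 1 := by
      rw [← Real.cos_two_mul]; congr 1; ring
    have h2 : 0 ≤ Real.cos (δ / 2) := Real.cos_nonneg_of_neg_pi_div_two_le_of_le (by linarith) (by linarith)
    have h3 := Real.cos_le_one (δ / 2)
    nlinarith
  have h5 : 0 < A * (1 - Real.cos δ) := mul_pos hApos (by linarith)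
  have h6 : (1 / 2 : ℝ) ≤ (∑ j ∈ B, w j) * N := by
    have : (1 / 2 : ℝ) * (A * (1 - Real.cos δ)) ≤ (∑ j ∈ B, w j) * N * (A * (1 - Real.cos δ)) := by
      nlinarith
    exact le_of_mul_le_mul_right this h5
  rw [div_le_iff₀ (by positivity)]
  linarith

/-! ### Eigenbases and the eigenvalue counts in an arc -/

lemma mem_bin {n : ℕ} {θ : Fin n → ℝ} {I : Set Real.Angle} {j : Fin n} :
    j ∈ bin θ I ↔ (θ j : Real.Angle) ∈ I := by
  classical
  simp [bin]

lemma sum_norm_sq_eigenvectors {n : ℕ} (ψ : OrthonormalBasis (Fin n) ℂ (EuclideanSpace ℂ (Fin n)))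
    (x : Fin n) : ∑ j, ‖ψ j x‖ ^ 2 = 1 := by
  have := ψ.sum_sq_norm_inner_right (EuclideanSpace.single x (1 : ℂ))
  simpa [EuclideanSpace.inner_single_right] using this

lemma sum_norm_sq_coord {n : ℕ} (ψ : OrthonormalBasis (Fin n) ℂ (EuclideanSpace ℂ (Fin n)))
    (j : Fin n) : ∑ x, ‖ψ j x‖ ^ 2 = 1 := by
  rw [← EuclideanSpace.norm_sq_eq, ψ.norm_eq_one, one_pow]

lemma sum_conj_mul_eigenvectors {n : ℕ}
    (ψ : OrthonormalBasis (Fin n) ℂ (EuclideanSpace ℂ (Fin n))) (x y : Fin n) :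
    ∑ j, (starRingEnd ℂ) (ψ j x) * ψ j y = if y = x then 1 else 0 := by
  have := congrArg (fun v : EuclideanSpace ℂ (Fin n) => v y)
    (ψ.sum_repr' (EuclideanSpace.single x (1 : ℂ)))
  simpa [Pi.single_apply, EuclideanSpace.inner_single_right] using this

lemma IsEigenbasis.mulVec {n : ℕ} {U : Matrix (Fin n) (Fin n) ℂ} {θ : Fin n → ℝ}
    {ψ : OrthonormalBasis (Fin n) ℂ (EuclideanSpace ℂ (Fin n))} (h : IsEigenbasis U θ ψ)
    (j : Fin n) : Matrix.mulVec U (ψ j).ofLp = Complex.exp (θ j * Complex.I) • (ψ j).ofLp := by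
  exact congrArg WithLp.ofLp (h j)

lemma IsEigenbasis.pow_mulVec {n : ℕ} {U : Matrix (Fin n) (Fin n) ℂ} {θ : Fin n → ℝ}
    {ψ : OrthonormalBasis (Fin n) ℂ (EuclideanSpace ℂ (Fin n))} (h : IsEigenbasis U θ ψ)
    (j : Fin n) (l : ℕ) :
    Matrix.mulVec (U ^ l) (ψ j).ofLp = Complex.exp (θ j * Complex.I) ^ l • (ψ j).ofLp := by
  induction l with
  | zero => simp
  | succ l ih =>
    rw [pow_succ, ← Matrix.mulVec_mulVec, h.mulVec, Matrix.mulVec_smul, ih, smul_smul, pow_succ,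
      mul_comm]

/-- The diagonal entries of the powers of `U` are the moments of the spectral measure of `U`
at a coordinate vector. -/
lemma IsEigenbasis.pow_diag {n : ℕ} {U : Matrix (Fin n) (Fin n) ℂ} {θ : Fin n → ℝ}
    {ψ : OrthonormalBasis (Fin n) ℂ (EuclideanSpace ℂ (Fin n))} (h : IsEigenbasis U θ ψ)
    (x : Fin n) (l : ℕ) :
    (U ^ l) x x = ∑ j, ((‖ψ j x‖ ^ 2 : ℝ) : ℂ) * Complex.exp (θ j * Complex.I) ^ l := by
  have h1 : (U ^ l) x x = ∑ y, (U ^ l) x y * ∑ j, (starRingEnd ℂ) (ψ j x) * ψ j y := by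
    simp_rw [sum_conj_mul_eigenvectors]; simp
  rw [h1]
  simp_rw [Finset.mul_sum]
  rw [Finset.sum_comm]
  refine Finset.sum_congr rfl fun j _ => ?_
  have h2 := congrFun (h.pow_mulVec j l) x
  simp only [Matrix.mulVec, dotProduct, Pi.smul_apply, smul_eq_mul] at h2
  calc ∑ y, (U ^ l) x y * ((starRingEnd ℂ) (ψ j x) * ψ j y)
      = (starRingEnd ℂ) (ψ j x) * ∑ y, (U ^ l) x y * ψ j y := by
        rw [Finset.mul_sum]; exact Finset.sum_congr rfl fun y _ => by ring
    _ = _ := by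
        rw [h2, ← Complex.normSq_eq_norm_sq, Complex.normSq_eq_conj_mul_self]; ring

/-- Pointwise Weyl law in an arc, with non-optimal constants: if most diagonal entries of
`U, …, U ^ R` vanish, where `R` is at least of the order of `1 / len`, then the arc contains at
least of the order of `n * len` eigenvalues, and its spectral projection has diagonal entries at
most of order `len` outside the exceptional set. -/
lemma IsEigenbasis.arc_bounds {n : ℕ} {U : Matrix (Fin n) (Fin n) ℂ} {θ : Fin n → ℝ}
    {ψ : OrthonormalBasis (Fin n) ℂ (EuclideanSpace ℂ (Fin n))} (h : IsEigenbasis U θ ψ)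
    {I : Set Real.Angle} {len : ℝ} (hI : IsArc I len) {R : ℕ} (hR : 6 * Real.pi ≤ R * len)
    {bad : Finset (Fin n)} (hgood : ∀ x ∉ bad, ∀ l : ℕ, 1 ≤ l → l ≤ R → (U ^ l) x x = 0) :
    (∀ x ∉ bad, ∑ j ∈ bin θ I, ‖ψ j x‖ ^ 2 ≤ 2 * len) ∧
      ((n : ℝ) - bad.card) * (len / (12 * Real.pi)) ≤ (bin θ I).card := by
  obtain ⟨hlen0, hlen1, a, J, hJ1, hJ2, rfl⟩ := hI
  have hπ := Real.pi_pos
  have hlen : 0 < len := by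
    rcases hlen0.lt_or_eq with h | h
    · exact h
    · rw [← h] at hR; linarith
  set α := a + len / 2 with hα
  set φ : Fin n → ℝ := fun j => θ j - α with hφ
  have hm : ∀ x ∉ bad, ∀ l : ℕ, 1 ≤ l → l ≤ R →
      ∑ j, ((‖ψ j x‖ ^ 2 : ℝ) : ℂ) * Complex.exp (φ j * Complex.I) ^ l = 0 := by
    intro x hx l hl1 hl2
    have h1 := hgood x hx l hl1 hl2
    rw [h.pow_diag] at h1
    have h2 : ∀ j, ((‖ψ j x‖ ^ 2 : ℝ) : ℂ) * Complex.exp (φ j * Complex.I) ^ l =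
        (((‖ψ j x‖ ^ 2 : ℝ) : ℂ) * Complex.exp (θ j * Complex.I) ^ l) *
          Complex.exp (-α * Complex.I) ^ l := by
      intro j
      rw [mul_assoc, ← mul_pow, ← Complex.exp_add]
      congr 3; rw [hφ]; push_cast; ring
    rw [Finset.sum_congr rfl fun j _ => h2 j, ← Finset.sum_mul, h1, zero_mul]
  have hw0 : ∀ x j, 0 ≤ ‖ψ j x‖ ^ 2 := fun x j => by positivity
  have hRlen : 6 * Real.pi / len ≤ R := by rwa [div_le_iff₀ hlen]
  constructor
  · intro x hx
    have h1 := sum_weights_arc_le (hw0 x) (sum_norm_sq_eigenvectors ψ x) (hm x hx)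
      (δ := len / 2) (by positivity) ?_
      (bin θ ((fun t : ℝ => (t : Real.Angle)) '' J)) ?_
    · linarith
    · refine le_trans ?_ hRlen
      rw [div_div_eq_mul_div]
      exact div_le_div_of_nonneg_right (by linarith [Real.two_le_pi]) hlen.le
    · intro j hj
      obtain ⟨s, hs, hsj⟩ := mem_bin.1 hj
      refine ⟨s - α, ?_, ?_⟩
      · have := hJ2 hs
        rw [abs_le]; constructor <;> rw [hα] <;> linarith [this.1, this.2]
      · simp only at hsj
        rw [hφ]; simp only [Real.Angle.coe_sub, hsj]
  · set N := ⌈2 * Real.pi / (len / 2)⌉₊ with hN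
    have hN1 : (N : ℝ) ≤ 6 * Real.pi / len := by
      have h1 := (Nat.ceil_lt_add_one (a := 2 * Real.pi / (len / 2)) (by positivity)).le
      have h2 : 1 ≤ 2 * Real.pi / len := by rw [le_div_iff₀ hlen]; linarith
      calc (N : ℝ) ≤ 2 * Real.pi / (len / 2) + 1 := h1
        _ ≤ 2 * Real.pi / (len / 2) + 2 * Real.pi / len := by linarith
        _ = 6 * Real.pi / len := by field_simp; ring
    have hNR : N ≤ R := by exact_mod_cast hN1.trans hRlen
    have hNpos : (0 : ℝ) < N := lt_of_lt_of_le (by positivity) (Nat.le_ceil _)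
    have hx1 : ∀ x ∈ badᶜ, len / (12 * Real.pi) ≤
        ∑ j ∈ bin θ ((fun t : ℝ => (t : Real.Angle)) '' J), ‖ψ j x‖ ^ 2 := by
      intro x hx
      have hx := Finset.mem_compl.1 hx
      refine le_trans ?_ (le_sum_weights_arc (hw0 x) (sum_norm_sq_eigenvectors ψ x) (hm x hx)
        (δ := len / 2) (by positivity) (by linarith) (Nat.le_ceil _) hNR _ ?_)
      · change _ ≤ 1 / (2 * (N : ℝ))
        rw [div_le_div_iff₀ (by positivity) (by positivity)]
        rw [le_div_iff₀ hlen] at hN1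
        linarith
      · intro j hj
        rw [mem_bin]
        set t := (φ j : Real.Angle).toReal with ht
        have hcos : Real.cos t = Real.cos (φ j) := by
          rw [ht, Real.Angle.cos_toReal, Real.Angle.cos_coe]
        have htπ : |t| ≤ Real.pi := Real.Angle.abs_toReal_le_pi _
        have htδ : |t| < len / 2 := by
          by_contra hcon
          have := Real.cos_le_cos_of_nonneg_of_le_pi (by positivity) htπ (not_lt.1 hcon)
          rw [Real.cos_abs, hcos] at this
          linarith
        rw [abs_lt] at htδ
        refine ⟨t + α, hJ1 ⟨?_, ?_⟩, ?_⟩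
        · rw [hα]; linarith [htδ.1]
        · rw [hα]; linarith [htδ.2]
        · simp only [Real.Angle.coe_add, ht, Real.Angle.coe_toReal]
          rw [← Real.Angle.coe_add, hφ]; simp
    calc ((n : ℝ) - bad.card) * (len / (12 * Real.pi))
        = ∑ x ∈ badᶜ, len / (12 * Real.pi) := by
          rw [Finset.sum_const, nsmul_eq_mul, Finset.card_compl, Nat.cast_sub (Finset.card_le_univ _),
            Fintype.card_fin]
      _ ≤ ∑ x ∈ badᶜ, ∑ j ∈ bin θ ((fun t : ℝ => (t : Real.Angle)) '' J), ‖ψ j x‖ ^ 2 :=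
          Finset.sum_le_sum hx1
      _ ≤ ∑ x, ∑ j ∈ bin θ ((fun t : ℝ => (t : Real.Angle)) '' J), ‖ψ j x‖ ^ 2 :=
          Finset.sum_le_sum_of_subset_of_nonneg (Finset.subset_univ _)
            fun x _ _ => Finset.sum_nonneg fun j _ => hw0 x j
      _ = _ := by
          rw [Finset.sum_comm]; simp [sum_norm_sq_coord]

/-! ### Mean ergodic theorem for ergodic maps -/

/-- The mean square of the Birkhoff averages of a function of mean zero tends to zero
(von Neumann's theorem for the Koopman operator). -/
lemma tendsto_integral_norm_sq_birkhoff {X : Type*} [MeasurableSpace X] {μ : Measure X}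
    [IsProbabilityMeasure μ] {S : X → X} (hS : Ergodic S μ) {g : X → ℂ} (hg : MemLp g 2 μ)
    (h0 : ∫ z, g z ∂μ = 0) :
    Tendsto (fun T : ℕ => ∫ z, ‖(T : ℂ)⁻¹ * ∑ t ∈ Finset.range T, g (S^[t] z)‖ ^ 2 ∂μ)
      atTop (𝓝 0) := by
  have hmp := hS.toMeasurePreserving
  set κ : Lp ℂ 2 μ →L[ℂ] Lp ℂ 2 μ :=
    (Lp.compMeasurePreservingₗᵢ ℂ S hmp).toContinuousLinearMap with hκ
  have hκ1 : ‖κ‖ ≤ 1 := LinearIsometry.norm_toContinuousLinearMap_le _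
  have hκapp : ∀ f, κ f = Lp.compMeasurePreserving S hmp f := fun f => rfl
  have hmem : ∀ t : ℕ, MemLp (fun z => g (S^[t] z)) 2 μ := fun t =>
    hg.comp_measurePreserving (hmp.iterate t)
  have hiter : ∀ t : ℕ, κ^[t] (hg.toLp g) = (hmem t).toLp _ := by
    intro t
    have : (κ : Lp ℂ 2 μ → Lp ℂ 2 μ) = Lp.compMeasurePreserving S hmp := rfl
    rw [this, Lp.compMeasurePreserving_iterate, Lp.toLp_compMeasurePreserving]
    rfl
  have hfix : (κ.eqLocus (1 : Lp ℂ 2 μ →L[ℂ] Lp ℂ 2 μ)).orthogonalProjectionOnto (hg.toLp g) = 0 := by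
    rw [Submodule.orthogonalProjectionOnto_eq_zero_iff, Submodule.mem_orthogonal]
    intro f hf
    have hf' : Lp.compMeasurePreserving S hmp f = f := hf
    have hae : f ∘ S =ᵐ[μ] f := by
      have := Lp.coeFn_compMeasurePreserving f hmp
      rw [hf'] at this
      exact this.symm
    obtain ⟨c, hc⟩ := hS.quasiErgodic.ae_eq_const_of_ae_eq_comp_ae
      (Lp.aestronglyMeasurable f) hae
    rw [MeasureTheory.L2.inner_def]
    have : (fun a => inner ℂ (f a) ((hg.toLp g) a)) =ᵐ[μ] fun a => (starRingEnd ℂ) c * g a := by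
      filter_upwards [hc, hg.coeFn_toLp] with a h1 h2
      rw [h1, h2]; simp [mul_comm]
    rw [integral_congr_ae this, integral_const_mul, h0, mul_zero]
  have hlim := ContinuousLinearMap.tendsto_birkhoffAverage_orthogonalProjection κ hκ1 (hg.toLp g)
  rw [hfix] at hlim
  have hnorm := (hlim.norm).pow 2
  simp only [ZeroMemClass.coe_zero, norm_zero, ne_eq, OfNat.ofNat_ne_zero, not_false_eq_true,
    zero_pow] at hnorm
  refine hnorm.congr fun T => ?_
  have hA : MemLp (fun z => (T : ℂ)⁻¹ * ∑ t ∈ Finset.range T, g (S^[t] z)) 2 μ :=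
    (memLp_finsetSum _ fun t _ => hmem t).const_mul _
  have hsum : birkhoffAverage ℂ κ _root_.id T (hg.toLp g) = hA.toLp _ := by
    rw [birkhoffAverage, birkhoffSum]
    simp only [id, hiter]
    ext1
    refine (Lp.coeFn_smul _ _).trans ?_
    refine EventuallyEq.trans ?_ hA.coeFn_toLp.symm
    have h1 : ∀ᵐ z ∂μ, ∀ t : ℕ, ((hmem t).toLp _ : X → ℂ) z = g (S^[t] z) :=
      ae_all_iff.2 fun t => (hmem t).coeFn_toLp
    filter_upwards [h1, Lp.coeFn_finsetSum (Finset.range T) fun t => (hmem t).toLp _] with z h1 h2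
    simp only [Pi.smul_apply, smul_eq_mul, h2, Finset.sum_apply, h1]
  rw [hsum, ← RCLike.ofReal_inj (K := ℂ), ← integral_ofReal]
  rw [RCLike.ofReal_pow, ← inner_self_eq_norm_sq_to_K (𝕜 := ℂ), MeasureTheory.L2.inner_def]
  refine integral_congr_ae ?_
  filter_upwards [hA.coeFn_toLp] with z hz
  rw [hz, inner_self_eq_norm_sq_to_K, RCLike.ofReal_pow]

/-! ### Branches of the interval map and their action on atoms -/

lemma IsAdmissible.exists_branch {S : ℝ → ℝ} {M₀ : ℕ} (hS : IsAdmissible S M₀) :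
    ∃ m c : Fin M₀ → ℤ, ∀ j, 2 ≤ |m j| ∧ slopeOn S M₀ j = m j ∧
      ∀ z ∈ atom M₀ j, S z = m j * z + c j / M₀ := by
  have hM : (0 : ℝ) < M₀ := by exact_mod_cast hS.pos
  have : ∀ j : Fin M₀, ∃ m c : ℤ, 2 ≤ |m| ∧ slopeOn S M₀ j = m ∧
      ∀ z ∈ atom M₀ j, S z = m * z + c / M₀ := by
    intro j
    obtain ⟨m, c, hmc⟩ := hS.linear j
    have hlt : (j : ℝ) / M₀ < ((j : ℝ) + 1) / M₀ := by gcongr; linarith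
    have hj1 : ((j : ℕ) : ℝ) + 1 ≤ M₀ := by exact_mod_cast j.2
    have hcont : Continuous fun z : ℝ => m * z + c := by fun_prop
    obtain ⟨_, ⟨i, -, rfl⟩, hi⟩ := hS.limit_right ((j : ℝ) / M₀) ⟨j, j.2.le, rfl⟩
      (by rw [div_lt_one hM]; linarith)
    obtain ⟨_, ⟨i', -, rfl⟩, hi'⟩ := hS.limit_left (((j : ℝ) + 1) / M₀)
      ⟨j + 1, j.2, by push_cast; rfl⟩ (by positivity)
    have e1 : (i : ℝ) / M₀ = m * ((j : ℝ) / M₀) + c := by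
      refine tendsto_nhds_unique hi
        ((hcont.tendsto ((j : ℝ) / M₀)).mono_left nhdsWithin_le_nhds |>.congr' ?_)
      filter_upwards [Ioo_mem_nhdsGT hlt] with z hz
      exact (hmc z hz).symm
    have e2 : (i' : ℝ) / M₀ = m * (((j : ℝ) + 1) / M₀) + c := by
      refine tendsto_nhds_unique hi'
        ((hcont.tendsto (((j : ℝ) + 1) / M₀)).mono_left nhdsWithin_le_nhds |>.congr' ?_)
      filter_upwards [Ioo_mem_nhdsLT hlt] with z hz
      exact (hmc z hz).symm
    have hm : m = ((i' - i : ℤ) : ℝ) := by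
      push_cast
      field_simp at e1 e2
      linarith
    have hc : c = ((i - (i' - i) * (j : ℕ) : ℤ) : ℝ) / M₀ := by
      push_cast at hm ⊢
      rw [hm] at e1
      field_simp at e1 ⊢
      linarith
    have hmid : ((j : ℝ) + 1 / 2) / M₀ ∈ atom M₀ j := by
      constructor
      · gcongr; linarith
      · gcongr; norm_num
    have hslope : slopeOn S M₀ j = m := by
      have : S =ᶠ[𝓝 (((j : ℝ) + 1 / 2) / M₀)] fun z => m * z + c := by
        filter_upwards [isOpen_Ioo.mem_nhds hmid] with z hz
        exact hmc z hz
      rw [slopeOn, this.deriv_eq]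
      simp
    have h2 := hS.two_le_slope j
    rw [hslope, hm] at h2
    refine ⟨i' - i, i - (i' - i) * (j : ℕ), by exact_mod_cast h2, by rw [hslope, hm], ?_⟩
    intro z hz
    rw [hmc z hz, ← hc, ← hm]
  choose m c h using this
  exact ⟨m, c, h⟩

lemma midpoint_mem_atom {n : ℕ} (x : Fin n) : ((x : ℝ) + 1 / 2) / n ∈ atom n x := by
  have hn : (0 : ℝ) < n := by exact_mod_cast x.pos
  constructor
  · gcongr; linarith
  · gcongr; norm_num

lemma mem_atom_iff {n : ℕ} {x : Fin n} {z : ℝ} :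
    z ∈ atom n x ↔ (x : ℝ) < n * z ∧ n * z < x + 1 := by
  have hn : (0 : ℝ) < n := by exact_mod_cast x.pos
  rw [atom, mem_Ioo, div_lt_iff₀ hn, lt_div_iff₀ hn, mul_comm z]

lemma atom_subset_Icc {n : ℕ} (x : Fin n) : atom n x ⊆ Icc 0 1 := by
  intro z hz
  have hn : (0 : ℝ) < n := by exact_mod_cast x.pos
  have hx : ((x : ℕ) : ℝ) + 1 ≤ n := by exact_mod_cast x.2
  rw [mem_atom_iff] at hz
  have : (0 : ℝ) ≤ (x : ℕ) := by positivity
  constructor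
  · by_contra h
    push Not at h
    nlinarith [mul_neg_of_pos_of_neg hn h]
  · by_contra h
    push Not at h
    nlinarith

lemma exists_atom_subset {M₀ n : ℕ} (h : M₀ ∣ n) (x : Fin n) :
    ∃ j : Fin M₀, atom n x ⊆ atom M₀ j := by
  obtain ⟨q, rfl⟩ := h
  have hpos := x.pos
  have hq : 0 < q := Nat.pos_of_mul_pos_left hpos
  refine ⟨⟨x / q, Nat.div_lt_of_lt_mul (lt_of_lt_of_eq x.2 (mul_comm _ _))⟩, fun z hz => ?_⟩
  rw [mem_atom_iff] at hz ⊢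
  have h1 : ((x / q : ℕ) : ℝ) * q ≤ (x : ℕ) := by exact_mod_cast Nat.div_mul_le_self _ _
  have h2 : ((x : ℕ) : ℝ) + 1 ≤ (((x / q : ℕ) : ℝ) + 1) * q := by
    exact_mod_cast Nat.lt_mul_of_div_lt (Nat.lt_succ_self _) hq
  have hq' : (0 : ℝ) < q := by exact_mod_cast hq
  push_cast at hz
  simp only
  constructor
  · refine lt_of_mul_lt_mul_right ?_ hq'.le
    linarith [hz.1]
  · refine lt_of_mul_lt_mul_right ?_ hq'.le
    linarith [hz.2]

/-- An affine map with integer data respecting the partition into `n` atoms maps each atom onto a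
union of atoms, up to endpoints. -/
lemma atom_subset_image {M₀ n : ℕ} (h : M₀ ∣ n) {m c : ℤ} (hm : m ≠ 0) {x y : Fin n} {z : ℝ}
    (hz : z ∈ atom n x) (hzy : (m : ℝ) * z + c / M₀ ∈ atom n y) {w : ℝ} (hw : w ∈ atom n y) :
    ∃ z' ∈ atom n x, (m : ℝ) * z' + c / M₀ = w := by
  obtain ⟨q, rfl⟩ := h
  have hpos := x.pos
  have hM : 0 < M₀ := Nat.pos_of_mul_pos_right hpos
  have hM' : (0 : ℝ) < M₀ := by exact_mod_cast hM
  have hm' : (m : ℝ) ≠ 0 := by exact_mod_cast hm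
  refine ⟨(w - c / M₀) / m, ?_, by field_simp; ring⟩
  rw [mem_atom_iff] at *
  push_cast at *
  have e1 : (M₀ * q : ℝ) * (m * z + c / M₀) = m * (M₀ * q * z) + c * q := by field_simp
  have e2 : (M₀ * q : ℝ) * ((w - c / M₀) / m) = (M₀ * q * w - c * q) / m := by field_simp
  rw [e1] at hzy
  rw [e2]
  set u := (M₀ * q : ℝ) * z
  set v := (M₀ * q : ℝ) * w
  rcases lt_or_gt_of_ne hm with h0 | h0
  · have h0' : (m : ℝ) < 0 := by exact_mod_cast h0
    have h1 : m * ((x : ℕ) : ℤ) + m + c * q ≤ (y : ℕ) := by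
      have : (m : ℝ) * ((x : ℕ) : ℝ) + m + c * q < (y : ℕ) + 1 := by nlinarith
      exact Int.lt_add_one_iff.1 (by exact_mod_cast this)
    have h2 : ((y : ℕ) : ℤ) + 1 ≤ m * ((x : ℕ) : ℤ) + c * q := by
      have : ((y : ℕ) : ℝ) < (m : ℝ) * ((x : ℕ) : ℝ) + c * q := by nlinarith
      exact Int.add_one_le_iff.2 (by exact_mod_cast this)
    have h1' : (m : ℝ) * ((x : ℕ) : ℝ) + m + c * q ≤ (y : ℕ) := by exact_mod_cast h1
    have h2' : ((y : ℕ) : ℝ) + 1 ≤ (m : ℝ) * ((x : ℕ) : ℝ) + c * q := by exact_mod_cast h2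
    constructor
    · rw [lt_div_iff_of_neg h0']; linarith
    · rw [div_lt_iff_of_neg h0']; linarith
  · have h0' : (0 : ℝ) < m := by exact_mod_cast h0
    have h1 : m * ((x : ℕ) : ℤ) + c * q ≤ (y : ℕ) := by
      have : (m : ℝ) * ((x : ℕ) : ℝ) + c * q < (y : ℕ) + 1 := by nlinarith
      exact Int.lt_add_one_iff.1 (by exact_mod_cast this)
    have h2 : ((y : ℕ) : ℤ) + 1 ≤ m * ((x : ℕ) : ℤ) + m + c * q := by
      have : ((y : ℕ) : ℝ) < (m : ℝ) * ((x : ℕ) : ℝ) + m + c * q := by nlinarith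
      exact Int.add_one_le_iff.2 (by exact_mod_cast this)
    have h1' : (m : ℝ) * ((x : ℕ) : ℝ) + c * q ≤ (y : ℕ) := by exact_mod_cast h1
    have h2' : ((y : ℕ) : ℝ) + 1 ≤ (m : ℝ) * ((x : ℕ) : ℝ) + m + c * q := by exact_mod_cast h2
    constructor
    · rw [lt_div_iff₀ h0']; linarith
    · rw [div_lt_iff₀ h0']; linarith

lemma IsQuantization.exists_mem_atom {S : ℝ → ℝ} {n : ℕ} {U : Matrix (Fin n) (Fin n) ℂ}
    (hU : IsQuantization S n U) {x y : Fin n} (h : U x y ≠ 0) :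
    ∃ z ∈ atom n x, S z ∈ atom n y := by
  have h1 : markovMatrix S n x y ≠ 0 := by
    rw [← hU.normSq]; positivity
  rw [markovMatrix] at h1
  have h2 : (S '' atom n x ∩ atom n y).Nonempty := by
    by_contra hcon
    rw [if_neg hcon] at h1
    exact h1 rfl
  obtain ⟨_, ⟨z, hz, rfl⟩, hy⟩ := h2
  exact ⟨z, hz, hy⟩

/-- If `U x y ≠ 0`, then the atom `y` lies in the image of the atom `x`. -/
lemma IsQuantization.atom_subset_image {S : ℝ → ℝ} {M₀ n : ℕ} (hS : IsAdmissible S M₀)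
    (hn : M₀ ∣ n) {U : Matrix (Fin n) (Fin n) ℂ}
    (hU : IsQuantization S n U) {x y : Fin n} (h : U x y ≠ 0) :
    atom n y ⊆ S '' atom n x := by
  obtain ⟨m, c, hb⟩ := hS.exists_branch
  obtain ⟨j, hj⟩ := exists_atom_subset hn x
  obtain ⟨z, hz, hzy⟩ := hU.exists_mem_atom h
  obtain ⟨h2, -, hlin⟩ := hb j
  rw [hlin z (hj hz)] at hzy
  intro w hw
  obtain ⟨z', hz', e⟩ := IntervalMap.atom_subset_image hn (by rintro h0; simp [h0] at h2) hz hzy hw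
  exact ⟨z', hz', by rw [hlin z' (hj hz'), e]⟩

/-! ### Closed orbits of short length are rare -/

/-- A nonzero entry `(U ^ l) x y` forces the atom `y` to lie in the image of the atom `x` under
one of at most `M₀ ^ l` compositions `z ↦ p.1 * z + p.2` of branches of `S`. -/
lemma IsQuantization.exists_words {S : ℝ → ℝ} {M₀ n : ℕ} (hS : IsAdmissible S M₀)
    (hn : M₀ ∣ n) {U : Matrix (Fin n) (Fin n) ℂ} (hU : IsQuantization S n U) (l : ℕ) :
    ∃ W : Finset (ℝ × ℝ), W.card ≤ M₀ ^ l ∧ (∀ p ∈ W, 2 ^ l ≤ |p.1|) ∧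
      ∀ x y, (U ^ l) x y ≠ 0 → ∃ p ∈ W, ∀ w ∈ atom n y, ∃ z ∈ atom n x, p.1 * z + p.2 = w := by
  classical
  obtain ⟨m, c, hb⟩ := hS.exists_branch
  induction l with
  | zero =>
    refine ⟨{(1, 0)}, by simp, by simp, fun x y hxy => ⟨(1, 0), by simp, fun w hw => ?_⟩⟩
    have : x = y := by
      by_contra h
      simp [Matrix.one_apply_ne h] at hxy
    subst this
    exact ⟨w, hw, by simp⟩
  | succ l ih =>
    obtain ⟨W, hW1, hW2, hW3⟩ := ih
    refine ⟨(W ×ˢ Finset.univ).image fun a : (ℝ × ℝ) × Fin M₀ =>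
      ((m a.2 : ℝ) * a.1.1, (m a.2 : ℝ) * a.1.2 + c a.2 / M₀), ?_, ?_, ?_⟩
    · refine Finset.card_image_le.trans ?_
      rw [Finset.card_product, Finset.card_univ, Fintype.card_fin, pow_succ]
      gcongr
    · intro p hp
      obtain ⟨a, ha, rfl⟩ := Finset.mem_image.1 hp
      have h1 := hW2 a.1 (Finset.mem_product.1 ha).1
      have h2 : (2 : ℝ) ≤ |(m a.2 : ℝ)| := by exact_mod_cast (hb a.2).1
      rw [abs_mul, pow_succ, mul_comm]
      gcongr
    · intro x y hxy
      rw [pow_succ, Matrix.mul_apply] at hxy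
      obtain ⟨u, -, hu⟩ := Finset.exists_ne_zero_of_sum_ne_zero hxy
      obtain ⟨p, hp, hpu⟩ := hW3 x u (left_ne_zero_of_mul hu)
      obtain ⟨j, hj⟩ := exists_atom_subset hn u
      refine ⟨_, Finset.mem_image.2 ⟨(p, j), by simp [hp], rfl⟩, fun w hw => ?_⟩
      obtain ⟨z', hz', rfl⟩ := hU.atom_subset_image hS hn (right_ne_zero_of_mul hu) hw
      obtain ⟨z, hz, rfl⟩ := hpu z' hz'
      refine ⟨z, hz, ?_⟩
      rw [(hb j).2.2 _ (hj hz')]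
      ring

/-- An expanding affine map sends at most two atoms over themselves, because it has only one
fixed point. -/
lemma card_atoms_subset_image_le {n : ℕ} {p q : ℝ} (hp : 2 ≤ |p|) (s : Finset (Fin n))
    (hs : ∀ x ∈ s, ∀ w ∈ atom n x, ∃ z ∈ atom n x, p * z + q = w) : s.card ≤ 2 := by
  have hp1 : 1 ≤ |p - 1| := by
    have := abs_sub_abs_le_abs_sub p 1
    rw [abs_one] at this; linarith
  have hclose : ∀ x ∈ s, ∀ y ∈ s, (x : ℕ) < y + 2 := by
    intro x hx y hy
    have hn : (0 : ℝ) < n := by exact_mod_cast x.pos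
    obtain ⟨z, hz, ez⟩ := hs x hx _ (midpoint_mem_atom x)
    obtain ⟨z', hz', ez'⟩ := hs y hy _ (midpoint_mem_atom y)
    rw [mem_atom_iff] at hz hz'
    rw [eq_div_iff hn.ne'] at ez ez'
    have h1 : (p - 1) * (n * z - n * z') =
        ((x : ℕ) + 1 / 2 - n * z) - ((y : ℕ) + 1 / 2 - n * z') := by linarith
    have h2 : |n * z - n * z'| < 1 := by
      calc |n * z - n * z'| ≤ |p - 1| * |n * z - n * z'| :=
            le_mul_of_one_le_left (abs_nonneg _) hp1
        _ = |((x : ℕ) + 1 / 2 - n * z) - ((y : ℕ) + 1 / 2 - n * z')| := by rw [← abs_mul, h1]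
        _ < 1 := by rw [abs_lt]; constructor <;> linarith [hz.1, hz.2, hz'.1, hz'.2]
    have h3 : ((x : ℕ) : ℝ) < (y : ℕ) + 2 := by
      have := (abs_lt.1 h2).2
      linarith [hz.1, hz.2, hz'.1, hz'.2]
    exact_mod_cast h3
  rcases s.eq_empty_or_nonempty with rfl | hne
  · simp
  obtain ⟨x₀, hx₀, hmin⟩ := s.exists_min_image (fun x => (x : ℕ)) hne
  calc s.card = (s.image fun x : Fin n => (x : ℕ)).card :=
        (Finset.card_image_of_injective _ Fin.val_injective).symm
    _ ≤ (Finset.Ico (x₀ : ℕ) (x₀ + 2)).card := by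
        refine Finset.card_le_card fun a ha => ?_
        obtain ⟨x, hx, rfl⟩ := Finset.mem_image.1 ha
        exact Finset.mem_Ico.2 ⟨hmin x hx, hclose x hx x₀ hx₀⟩
    _ = 2 := by simp

open Classical in
/-- The coordinates at which one of the powers `U, …, U ^ R` has a nonzero diagonal entry. -/
noncomputable def recurrentSet {n : ℕ} (U : Matrix (Fin n) (Fin n) ℂ) (R : ℕ) : Finset (Fin n) :=
  Finset.univ.filter fun x => ∃ l ∈ Finset.Icc 1 R, (U ^ l) x x ≠ 0

lemma mem_recurrentSet {n : ℕ} {U : Matrix (Fin n) (Fin n) ℂ} {R : ℕ} {x : Fin n} :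
    x ∈ recurrentSet U R ↔ ∃ l ∈ Finset.Icc 1 R, (U ^ l) x x ≠ 0 := by
  simp [recurrentSet]

lemma pow_diag_eq_zero_of_notMem_recurrentSet {n : ℕ} {U : Matrix (Fin n) (Fin n) ℂ} {R : ℕ}
    {x : Fin n} (hx : x ∉ recurrentSet U R) (l : ℕ) (h1 : 1 ≤ l) (h2 : l ≤ R) :
    (U ^ l) x x = 0 := by
  by_contra h
  exact hx (mem_recurrentSet.2 ⟨l, Finset.mem_Icc.2 ⟨h1, h2⟩, h⟩)

lemma IsQuantization.card_recurrentSet_le {S : ℝ → ℝ} {M₀ n : ℕ} (hS : IsAdmissible S M₀)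
    (hn : M₀ ∣ n) {U : Matrix (Fin n) (Fin n) ℂ} (hU : IsQuantization S n U) (R : ℕ) :
    (recurrentSet U R).card ≤ R * (M₀ ^ R * 2) := by
  classical
  choose W hW1 hW2 hW3 using hU.exists_words hS hn
  have hsub : recurrentSet U R ⊆ (Finset.Icc 1 R).biUnion fun l => (W l).biUnion fun p =>
      Finset.univ.filter fun x : Fin n => ∀ w ∈ atom n x, ∃ z ∈ atom n x, p.1 * z + p.2 = w := by
    intro x hx
    obtain ⟨l, hl, hne⟩ := mem_recurrentSet.1 hx
    obtain ⟨p, hp, hpx⟩ := hW3 l x x hne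
    exact Finset.mem_biUnion.2 ⟨l, hl, Finset.mem_biUnion.2 ⟨p, hp, Finset.mem_filter.2
      ⟨Finset.mem_univ _, hpx⟩⟩⟩
  refine (Finset.card_le_card hsub).trans ((Finset.card_biUnion_le_card_mul _ _ (M₀ ^ R * 2) ?_).trans
    (by simp))
  intro l hl
  obtain ⟨hl1, hl2⟩ := Finset.mem_Icc.1 hl
  refine (Finset.card_biUnion_le_card_mul _ _ 2 fun p hp => ?_).trans ?_
  · refine card_atoms_subset_image_le (p := p.1) (q := p.2) ?_ _
      fun x hx => (Finset.mem_filter.1 hx).2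
    refine le_trans ?_ (hW2 l p hp)
    exact le_self_pow₀ (by norm_num) (by omega)
  · have := hS.pos
    gcongr
    exact (hW1 l).trans (Nat.pow_le_pow_right this hl2)

/-! ### Linearity of the iterates on fine partitions -/

lemma IsAdmissible.natAbs_dvd_slopeLcm {S : ℝ → ℝ} {M₀ : ℕ} {j : Fin M₀} {m : ℤ}
    (h : slopeOn S M₀ j = m) : m.natAbs ∣ slopeLcm S M₀ := by
  have := Finset.dvd_lcm (f := fun j : Fin M₀ => ⌊|slopeOn S M₀ j|⌋₊) (Finset.mem_univ j)
  simp only [h] at this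
  rwa [← Int.cast_abs, Int.abs_eq_natAbs, Int.cast_natCast, Nat.floor_natCast] at this

lemma IsAdmissible.two_le_slopeLcm {S : ℝ → ℝ} {M₀ : ℕ} (hS : IsAdmissible S M₀) :
    2 ≤ slopeLcm S M₀ := by
  obtain ⟨m, c, hb⟩ := hS.exists_branch
  have hne : slopeLcm S M₀ ≠ 0 := by
    rw [slopeLcm, Ne, Finset.lcm_eq_zero_iff]
    rintro ⟨j, -, hj⟩
    have h1 := hS.two_le_slope j
    have h2 := Nat.lt_floor_add_one |slopeOn S M₀ j|
    rw [hj] at h2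
    norm_num at h2
    linarith
  have h1 := Nat.le_of_dvd (Nat.pos_of_ne_zero hne)
    (IsAdmissible.natAbs_dvd_slopeLcm (hb ⟨0, hS.pos⟩).2.1)
  have h2 := (hb ⟨0, hS.pos⟩).1
  rw [Int.abs_eq_natAbs] at h2
  omega

/-- If `M₀ * L₀ ^ t` divides `n`, then `S^[t]` is affine on each of the `n` atoms: `S` maps
every `n`-atom onto an atom of the coarser partition into `n / |m|` atoms, where `m` is the
slope of `S`. -/
lemma IsAdmissible.iterate_affine {S : ℝ → ℝ} {M₀ : ℕ} (hS : IsAdmissible S M₀) (t : ℕ) :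
    ∀ n : ℕ, M₀ * slopeLcm S M₀ ^ t ∣ n → ∀ x : Fin n, ∃ s c : ℝ, |s| ≤ slopeLcm S M₀ ^ t ∧
      ∀ z ∈ atom n x, S^[t] z = s * z + c := by
  induction t with
  | zero => exact fun n _ x => ⟨1, 0, by simp, fun z _ => by simp⟩
  | succ t ih =>
    intro n hn x
    obtain ⟨m, c, hb⟩ := hS.exists_branch
    obtain ⟨j, hj⟩ := exists_atom_subset (dvd_of_mul_right_dvd hn) x
    obtain ⟨h2, hsl, hlin⟩ := hb j
    generalize m j = m at *
    generalize c j = c at *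
    obtain ⟨k, hk⟩ := IsAdmissible.natAbs_dvd_slopeLcm hsl
    obtain ⟨r, hr⟩ := hn
    set L := slopeLcm S M₀ with hL
    have hL2 : 2 ≤ L := hS.two_le_slopeLcm
    set q := L ^ t * k * r with hq
    have hn' : n = m.natAbs * (M₀ * q) := by
      rw [hr, pow_succ]
      nth_rw 2 [hk]
      rw [hq]; ring
    have hM : (0 : ℝ) < M₀ := by exact_mod_cast hS.pos
    have hnR : (n : ℝ) = |(m : ℝ)| * (M₀ * q) := by
      rw [hn']; push_cast; rw [Nat.cast_natAbs, Int.cast_abs]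
    have hm0 : (0 : ℝ) < |(m : ℝ)| := by
      have : (2 : ℝ) ≤ |(m : ℝ)| := by exact_mod_cast h2
      linarith
    have hnpos : (0 : ℝ) < n := by exact_mod_cast x.pos
    have hN : (0 : ℝ) < (M₀ * q : ℝ) := by
      rw [hnR] at hnpos; exact pos_of_mul_pos_right hnpos hm0.le
    have hmL : |(m : ℝ)| ≤ L := by
      have : m.natAbs ≤ L := Nat.le_of_dvd (by omega) ⟨k, hk⟩
      have h3 : ((m.natAbs : ℕ) : ℝ) ≤ L := by exact_mod_cast this
      rwa [Nat.cast_natAbs, Int.cast_abs] at h3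
    have hmid := midpoint_mem_atom x
    have hS01 := hS.mapsTo (atom_subset_Icc x hmid)
    rw [hlin _ (hj hmid)] at hS01
    -- the index of the image of the atom, in the partition into `M₀ * q` atoms
    obtain ⟨a, ha⟩ : ∃ a : ℤ, ∀ u : ℝ, ((x : ℕ) < n * u ∧ n * u < (x : ℕ) + 1 →
        (a : ℝ) < M₀ * q * (m * u + c / M₀) ∧ M₀ * q * (m * u + c / M₀) < a + 1) := by
      rcases lt_or_gt_of_ne (abs_pos.1 hm0) with h0 | h0
      · refine ⟨c * q - x - 1, fun u hu => ?_⟩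
        have : (M₀ * q : ℝ) * (m * u + c / M₀) = c * q - n * u := by
          rw [hnR, abs_of_neg h0]; field_simp; ring
        rw [this]; push_cast
        constructor <;> linarith [hu.1, hu.2]
      · refine ⟨x + c * q, fun u hu => ?_⟩
        have : (M₀ * q : ℝ) * (m * u + c / M₀) = c * q + n * u := by
          rw [hnR, abs_of_pos h0]; field_simp; ring
        rw [this]; push_cast
        constructor <;> linarith [hu.1, hu.2]
    obtain ⟨b1, b2⟩ := ha _ (mem_atom_iff.1 hmid)
    have ha0 : 0 ≤ a := by
      have : (0 : ℝ) < a + 1 := lt_of_le_of_lt (mul_nonneg hN.le hS01.1) b2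
      exact Int.lt_add_one_iff.1 (by exact_mod_cast this)
    lift a to ℕ using ha0
    have ha1 : a < M₀ * q := by
      have : (a : ℝ) < M₀ * q * 1 :=
        lt_of_lt_of_le (by exact_mod_cast b1) (mul_le_mul_of_nonneg_left hS01.2 hN.le)
      rw [mul_one] at this
      exact_mod_cast this
    obtain ⟨s, c', hs, hsc⟩ := ih (M₀ * q) ⟨k * r, by rw [hq]; ring⟩ ⟨a, ha1⟩
    refine ⟨s * m, s * (c / M₀) + c', ?_, fun z hz => ?_⟩
    · rw [abs_mul, pow_succ]
      gcongr
    · have h3 := ha z (mem_atom_iff.1 hz)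
      rw [Function.iterate_succ_apply, hlin z (hj hz), hsc]
      · ring
      · rw [mem_atom_iff]; push_cast; exact_mod_cast h3

lemma IsAdmissible.abs_iterate_sub_le {S : ℝ → ℝ} {M₀ : ℕ} (hS : IsAdmissible S M₀) {t n : ℕ}
    (h : M₀ * slopeLcm S M₀ ^ t ∣ n) {x : Fin n} {z z' : ℝ} (hz : z ∈ atom n x)
    (hz' : z' ∈ atom n x) : |S^[t] z - S^[t] z'| ≤ slopeLcm S M₀ ^ t / n := by
  obtain ⟨s, c, hs, hlin⟩ := hS.iterate_affine t n h x
  have hn : (0 : ℝ) < n := by exact_mod_cast x.pos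
  rw [hlin z hz, hlin z' hz']
  rw [mem_atom_iff] at hz hz'
  have h1 : |z - z'| ≤ 1 / n := by
    rw [le_div_iff₀ hn]
    calc |z - z'| * n = |n * z - n * z'| := by
          rw [← mul_sub, abs_mul, abs_of_pos hn, mul_comm]
      _ ≤ 1 := by rw [abs_le]; constructor <;> linarith [hz.1, hz.2, hz'.1, hz'.2]
  calc |s * z + c - (s * z' + c)| = |s| * |z - z'| := by rw [← abs_mul]; congr 1; ring
    _ ≤ slopeLcm S M₀ ^ t * (1 / n) := by gcongr
    _ = _ := by ring

/-! ### Averages over atoms -/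

/-- The average of `h` over the atom `x`, the diagonal entry of `observable n h`. -/
noncomputable def atomMean (n : ℕ) (h : ℝ → ℂ) (x : Fin n) : ℂ := (n : ℂ) * ∫ z in atom n x, h z

/-- The expectation of the diagonal matrix with entries `d` in the state `ψ`. -/
noncomputable def diagMean {n : ℕ} (d : Fin n → ℂ) (ψ : EuclideanSpace ℂ (Fin n)) : ℂ :=
  ∑ x, d x * ((‖ψ x‖ ^ 2 : ℝ) : ℂ)

lemma expectation_eq_diagMean {n : ℕ} (h : ℝ → ℂ) (ψ : EuclideanSpace ℂ (Fin n)) :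
    expectation h ψ = diagMean (atomMean n h) ψ := by
  rw [expectation, diagMean, PiLp.inner_apply]
  refine Finset.sum_congr rfl fun x _ => ?_
  have : (Matrix.toEuclideanLin (observable n h) ψ) x = atomMean n h x * ψ x := by
    change Matrix.mulVec (observable n h) ψ.ofLp x = _
    rw [observable, Matrix.mulVec_diagonal]; rfl
  rw [this, RCLike.inner_apply, ← Complex.normSq_eq_norm_sq, Complex.normSq_eq_conj_mul_self]
  ring

lemma measurableSet_atom {n : ℕ} (x : Fin n) : MeasurableSet (atom n x) := measurableSet_Ioo

lemma volume_real_atom {n : ℕ} (x : Fin n) : volume.real (atom n x) = 1 / n := by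
  have hn : (0 : ℝ) < n := by exact_mod_cast x.pos
  rw [atom, Real.volume_real_Ioo_of_le (by gcongr; linarith)]
  ring

lemma volume_atom_ne_top {n : ℕ} (x : Fin n) : volume (atom n x) ≠ ⊤ := by
  rw [atom, Real.volume_Ioo]; exact ENNReal.ofReal_ne_top

lemma atomMean_eq_average {n : ℕ} (h : ℝ → ℂ) (x : Fin n) :
    atomMean n h x = ⨍ z in atom n x, h z := by
  rw [setAverage_eq, volume_real_atom, atomMean, one_div, inv_inv]
  simp

lemma atomMean_congr {n : ℕ} {h h' : ℝ → ℂ} {x : Fin n} (H : ∀ z ∈ atom n x, h z = h' z) :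
    atomMean n h x = atomMean n h' x := by
  rw [atomMean, atomMean, setIntegral_congr_fun (measurableSet_atom x) H]

lemma norm_atomMean_sub_le {n : ℕ} {f : ℝ → ℂ} {x : Fin n} {v : ℂ} {ε : ℝ}
    (hf : IntegrableOn f (atom n x)) (h : ∀ z ∈ atom n x, ‖f z - v‖ ≤ ε) :
    ‖atomMean n f x - v‖ ≤ ε := by
  have hn : (0 : ℝ) < n := by exact_mod_cast x.pos
  have hn' : (n : ℂ) ≠ 0 := by exact_mod_cast hn.ne'
  have h1 : atomMean n f x - v = n * ∫ z in atom n x, (f z - v) := by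
    rw [integral_sub hf (integrableOn_const (volume_atom_ne_top x)), setIntegral_const,
      volume_real_atom, atomMean, mul_sub]
    congr 1
    rw [Complex.real_smul]; push_cast; field_simp
  rw [h1, norm_mul, Complex.norm_natCast]
  have h2 := norm_setIntegral_le_of_norm_le_const (μ := volume)
    (lt_top_iff_ne_top.2 (volume_atom_ne_top x)) h
  rw [volume_real_atom] at h2
  calc (n : ℝ) * ‖∫ z in atom n x, (f z - v)‖ ≤ n * (ε * (1 / n)) := by gcongr
    _ = ε := by field_simp

lemma norm_atomMean_le {n : ℕ} {f : ℝ → ℂ} {x : Fin n} {C : ℝ}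
    (hf : IntegrableOn f (atom n x)) (h : ∀ z ∈ atom n x, ‖f z‖ ≤ C) :
    ‖atomMean n f x‖ ≤ C := by
  simpa using norm_atomMean_sub_le (v := 0) hf (by simpa using h)

lemma norm_sq_atomMean_le {n : ℕ} {f : ℝ → ℂ} {x : Fin n}
    (hf : IntegrableOn f (atom n x)) (hf2 : IntegrableOn (fun z => ‖f z‖ ^ 2) (atom n x)) :
    ‖atomMean n f x‖ ^ 2 ≤ n * ∫ z in atom n x, ‖f z‖ ^ 2 := by
  have hn : (0 : ℝ) < n := by exact_mod_cast x.pos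
  have h0 : volume (atom n x) ≠ 0 := by
    intro h
    have h1 := volume_real_atom x
    rw [Measure.real, h, ENNReal.toReal_zero] at h1
    have : (0 : ℝ) < 1 / n := by positivity
    linarith
  have hconv : ConvexOn ℝ univ (fun z : ℂ => ‖z‖ ^ 2) :=
    (convexOn_univ_norm (E := ℂ)).pow (fun _ _ => norm_nonneg _) 2
  have := hconv.map_set_average_le (f := f) (by fun_prop) isClosed_univ h0 (volume_atom_ne_top x)
    (by simp) hf hf2
  rw [atomMean_eq_average]
  refine this.trans (le_of_eq ?_)
  rw [setAverage_eq, volume_real_atom, one_div, inv_inv, smul_eq_mul]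

lemma pairwise_disjoint_atom (n : ℕ) : Pairwise (Function.onFun Disjoint (atom n)) := by
  intro x y hxy
  rw [Function.onFun, Set.disjoint_left]
  intro z hx hy
  rw [mem_atom_iff] at hx hy
  have h1 : (x : ℕ) < (y : ℕ) + 1 := by exact_mod_cast hx.1.trans hy.2
  have h2 : (y : ℕ) < (x : ℕ) + 1 := by exact_mod_cast hy.1.trans hx.2
  exact hxy (Fin.ext (by omega))

lemma sum_norm_sq_atomMean_le {n : ℕ} {f : ℝ → ℂ} (hf : IntegrableOn f (Icc 0 1))
    (hf2 : IntegrableOn (fun z => ‖f z‖ ^ 2) (Icc 0 1)) :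
    ∑ x : Fin n, ‖atomMean n f x‖ ^ 2 ≤ n * ∫ z, ‖f z‖ ^ 2 ∂leb01 := by
  calc ∑ x : Fin n, ‖atomMean n f x‖ ^ 2
      ≤ ∑ x : Fin n, n * ∫ z in atom n x, ‖f z‖ ^ 2 :=
        Finset.sum_le_sum fun x _ => norm_sq_atomMean_le (hf.mono_set (atom_subset_Icc x))
          (hf2.mono_set (atom_subset_Icc x))
    _ = n * ∫ z in ⋃ x : Fin n, atom n x, ‖f z‖ ^ 2 := by
        rw [← Finset.mul_sum, integral_iUnion_fintype measurableSet_atom (pairwise_disjoint_atom n)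
          fun x => hf2.mono_set (atom_subset_Icc x)]
    _ ≤ _ := by
        refine mul_le_mul_of_nonneg_left ?_ (by positivity)
        exact setIntegral_mono_set hf2 (Eventually.of_forall fun z => by positivity)
          (LE.le.eventuallyLE (iUnion_subset atom_subset_Icc))

lemma norm_sq_diagMean_le {n : ℕ} (d : Fin n → ℂ) {ψ : EuclideanSpace ℂ (Fin n)}
    (hψ : ‖ψ‖ = 1) : ‖diagMean d ψ‖ ^ 2 ≤ ∑ x, ‖d x‖ ^ 2 * ‖ψ x‖ ^ 2 := by
  have h1 : ‖diagMean d ψ‖ ≤ ∑ x, (‖d x‖ * ‖ψ x‖) * ‖ψ x‖ := by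
    refine (norm_sum_le _ _).trans (le_of_eq (Finset.sum_congr rfl fun x _ => ?_))
    rw [norm_mul, Complex.norm_real, Real.norm_of_nonneg (by positivity)]; ring
  have h2 : ∑ x, ‖ψ x‖ ^ 2 = 1 := by
    rw [← EuclideanSpace.norm_sq_eq, hψ, one_pow]
  calc ‖diagMean d ψ‖ ^ 2 ≤ (∑ x, (‖d x‖ * ‖ψ x‖) * ‖ψ x‖) ^ 2 := by gcongr
    _ ≤ (∑ x, (‖d x‖ * ‖ψ x‖) ^ 2) * ∑ x, ‖ψ x‖ ^ 2 := Finset.sum_mul_sq_le_sq_mul_sq _ _ _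
    _ = _ := by rw [h2, mul_one]; exact Finset.sum_congr rfl fun x _ => by ring

/-! ### Approximate invariance of expectations (Egorov property) -/

lemma IsQuantization.sum_norm_sq_row {S : ℝ → ℝ} {n : ℕ} {U : Matrix (Fin n) (Fin n) ℂ}
    (hU : IsQuantization S n U) (x : Fin n) : ∑ y, ‖U x y‖ ^ 2 = 1 := by
  have h := congrFun (congrFun (Matrix.mem_unitaryGroup_iff.1 hU.unitary) x) x
  rw [Matrix.mul_apply, Matrix.one_apply_eq] at h
  have h2 : ∑ y, ((‖U x y‖ ^ 2 : ℝ) : ℂ) = 1 := by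
    rw [← h]
    refine Finset.sum_congr rfl fun y _ => ?_
    rw [Matrix.star_apply, ← Complex.normSq_eq_norm_sq, ← Complex.mul_conj]; rfl
  exact_mod_cast h2

/-- If the entries of two diagonal matrices agree up to `ε` along the nonzero entries of `U`, then
`U` almost intertwines them, and eigenvectors of `U` cannot distinguish them. -/
lemma IsQuantization.norm_diagMean_sub_le {S : ℝ → ℝ} {n : ℕ} {U : Matrix (Fin n) (Fin n) ℂ}
    (hU : IsQuantization S n U) {θ : Fin n → ℝ}
    {ψ : OrthonormalBasis (Fin n) ℂ (EuclideanSpace ℂ (Fin n))} (h : IsEigenbasis U θ ψ)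
    (j : Fin n) {d e : Fin n → ℂ} {ε : ℝ} (hε : 0 ≤ ε)
    (hde : ∀ x y, U x y ≠ 0 → ‖d y - e x‖ ≤ ε) :
    ‖diagMean d (ψ j) - diagMean e (ψ j)‖ ≤ ε * √n := by
  set v : Fin n → ℂ := (ψ j).ofLp with hv
  set lam := Complex.exp (θ j * Complex.I) with hlam
  have hlam1 : ‖lam‖ = 1 := Complex.norm_exp_ofReal_mul_I _
  have hUv : Matrix.mulVec U v = lam • v := h.mulVec j
  have hv1 : ∑ x, ‖v x‖ ^ 2 = 1 := sum_norm_sq_coord ψ j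
  have hsq : ∀ x, ((‖v x‖ ^ 2 : ℝ) : ℂ) = (starRingEnd ℂ) (v x) * v x := fun x => by
    rw [← Complex.normSq_eq_norm_sq, Complex.normSq_eq_conj_mul_self]
  have hd : diagMean d (ψ j) =
      ∑ x, (starRingEnd ℂ) (lam * v x) * ∑ y, U x y * (d y * v y) := by
    have h1 : star (Matrix.mulVec U v) ⬝ᵥ Matrix.mulVec U (fun y => d y * v y) =
        star v ⬝ᵥ fun y => d y * v y := by
      rw [Matrix.star_mulVec, Matrix.dotProduct_mulVec, Matrix.vecMul_vecMul]
      have : U.conjTranspose * U = 1 := Matrix.mem_unitaryGroup_iff'.1 hU.unitary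
      rw [this, Matrix.vecMul_one]
    rw [hUv] at h1
    simp only [dotProduct, Pi.star_apply, Pi.smul_apply, smul_eq_mul, Matrix.mulVec] at h1
    rw [diagMean]
    refine Eq.trans ?_ h1.symm
    refine Finset.sum_congr rfl fun x _ => ?_
    change d x * ((‖v x‖ ^ 2 : ℝ) : ℂ) = (starRingEnd ℂ) (v x) * _
    rw [hsq]; ring
  have he : diagMean e (ψ j) =
      ∑ x, (starRingEnd ℂ) (lam * v x) * ∑ y, U x y * (e x * v y) := by
    rw [diagMean]
    refine Finset.sum_congr rfl fun x _ => ?_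
    have h1 : ∑ y, U x y * v y = lam * v x := congrFun hUv x
    have h2 : ∑ y, U x y * (e x * v y) = e x * (lam * v x) := by
      rw [← h1, Finset.mul_sum]; exact Finset.sum_congr rfl fun y _ => by ring
    have h3 : (starRingEnd ℂ) lam * lam = 1 := by
      rw [← Complex.normSq_eq_conj_mul_self, Complex.normSq_eq_norm_sq, hlam1]; simp
    change e x * ((‖v x‖ ^ 2 : ℝ) : ℂ) = _
    rw [h2, hsq, map_mul]
    linear_combination (-e x * (starRingEnd ℂ) (v x) * v x) * h3
  have hrow : ∀ x, ‖∑ y, U x y * ((d y - e x) * v y)‖ ≤ ε := by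
    intro x
    have h1 : ‖∑ y, U x y * ((d y - e x) * v y)‖ ≤ ε * ∑ y, ‖U x y‖ * ‖v y‖ := by
      rw [Finset.mul_sum]
      refine (norm_sum_le _ _).trans (Finset.sum_le_sum fun y _ => ?_)
      rw [norm_mul, norm_mul]
      by_cases hxy : U x y = 0
      · simp [hxy]
      · have := hde x y hxy
        calc ‖U x y‖ * (‖d y - e x‖ * ‖v y‖) = ‖d y - e x‖ * (‖U x y‖ * ‖v y‖) := by ring
          _ ≤ _ := by gcongr
    have h2 : (∑ y, ‖U x y‖ * ‖v y‖) ^ 2 ≤ 1 := by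
      have := Finset.sum_mul_sq_le_sq_mul_sq Finset.univ (fun y => ‖U x y‖) (fun y => ‖v y‖)
      rwa [hU.sum_norm_sq_row, hv1, mul_one] at this
    have h3 : ∑ y, ‖U x y‖ * ‖v y‖ ≤ 1 := by
      by_contra hcon
      nlinarith
    calc _ ≤ ε * ∑ y, ‖U x y‖ * ‖v y‖ := h1
      _ ≤ ε * 1 := by gcongr
      _ = ε := mul_one _
  have hsum : ∑ x, ‖v x‖ ≤ √n := by
    refine Real.le_sqrt_of_sq_le ?_
    have := sq_sum_le_card_mul_sum_sq (s := Finset.univ) (f := fun x => ‖v x‖)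
    rwa [hv1, mul_one, Finset.card_univ, Fintype.card_fin] at this
  rw [hd, he, ← Finset.sum_sub_distrib]
  calc _ ≤ ∑ x, ‖v x‖ * ε := by
        refine (norm_sum_le _ _).trans (Finset.sum_le_sum fun x _ => ?_)
        rw [← mul_sub, ← Finset.sum_sub_distrib, norm_mul, RCLike.norm_conj, norm_mul, hlam1, one_mul]
        have : ∑ y, (U x y * (d y * v y) - U x y * (e x * v y)) =
            ∑ y, U x y * ((d y - e x) * v y) := Finset.sum_congr rfl fun y _ => by ring
        rw [this]
        gcongr
        exact hrow x
    _ = ε * ∑ x, ‖v x‖ := by rw [← Finset.sum_mul, mul_comm]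
    _ ≤ _ := by gcongr

lemma integrableOn_comp_iterate {S : ℝ → ℝ} (hS : Measurable S) {g : ℝ → ℂ} (hg : Continuous g)
    {C : ℝ} (hC : ∀ z, ‖g z‖ ≤ C) (t : ℕ) : IntegrableOn (fun z => g (S^[t] z)) (Icc 0 1) :=
  Measure.integrableOn_of_bounded (M := C) (by simp)
    ((hg.measurable.comp (hS.iterate t)).aestronglyMeasurable)
    (Eventually.of_forall fun z => hC _)

lemma IsAdmissible.measurable {S : ℝ → ℝ} {M₀ : ℕ} (hS : IsAdmissible S M₀) : Measurable S :=
  hS.measurePreserving.measurable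

/-- Replacing `g ∘ S^[t]` by `g ∘ S^[t + 1]` changes the averages over atoms only slightly along
the nonzero entries of `U`. -/
lemma IsQuantization.norm_atomMean_iterate_sub_le {S : ℝ → ℝ} {M₀ n : ℕ} (hS : IsAdmissible S M₀)
    {U : Matrix (Fin n) (Fin n) ℂ} (hU : IsQuantization S n U) {g : ℝ → ℂ} {K : NNReal}
    (hg : LipschitzWith K g) {C : ℝ} (hC : ∀ z, ‖g z‖ ≤ C) {t : ℕ}
    (hn : M₀ * slopeLcm S M₀ ^ (t + 1) ∣ n) {x y : Fin n} (hxy : U x y ≠ 0) :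
    ‖atomMean n (fun z => g (S^[t] z)) y - atomMean n (fun z => g (S^[t + 1] z)) x‖ ≤
      2 * (K * (slopeLcm S M₀ ^ (t + 1) / n)) := by
  set v := g (S^[t + 1] (((x : ℝ) + 1 / 2) / n)) with hv
  have hx : ∀ z ∈ atom n x, ‖g (S^[t + 1] z) - v‖ ≤ K * (slopeLcm S M₀ ^ (t + 1) / n) := by
    intro z hz
    have := hg.dist_le_mul (S^[t + 1] z) (S^[t + 1] (((x : ℝ) + 1 / 2) / n))
    rw [dist_eq_norm, Real.dist_eq] at this
    refine this.trans ?_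
    gcongr
    exact hS.abs_iterate_sub_le hn hz (midpoint_mem_atom x)
  have hint := fun (s : ℕ) (u : Fin n) =>
    (integrableOn_comp_iterate hS.measurable hg.continuous hC s).mono_set (atom_subset_Icc u)
  have h1 := norm_atomMean_sub_le (hint (t + 1) x) hx
  have h2 : ‖atomMean n (fun z => g (S^[t] z)) y - v‖ ≤ K * (slopeLcm S M₀ ^ (t + 1) / n) := by
    refine norm_atomMean_sub_le (hint t y) fun w hw => ?_
    obtain ⟨z, hz, rfl⟩ := hU.atom_subset_image hS (dvd_of_mul_right_dvd hn) hxy hw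
    exact hx z hz
  calc _ = ‖(atomMean n (fun z => g (S^[t] z)) y - v) -
        (atomMean n (fun z => g (S^[t + 1] z)) x - v)‖ := by congr 1; ring
    _ ≤ _ := (norm_sub_le _ _).trans (by linarith)

/-- The Birkhoff average of length `T` of `g` along the orbits of `S`. -/
noncomputable def timeAverage (S : ℝ → ℝ) (g : ℝ → ℂ) (T : ℕ) (z : ℝ) : ℂ :=
  (T : ℂ)⁻¹ * ∑ t ∈ Finset.range T, g (S^[t] z)

lemma IsQuantization.norm_expectation_sub_timeAverage_le {S : ℝ → ℝ} {M₀ n : ℕ}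
    (hS : IsAdmissible S M₀) {U : Matrix (Fin n) (Fin n) ℂ} (hU : IsQuantization S n U)
    {θ : Fin n → ℝ} {ψ : OrthonormalBasis (Fin n) ℂ (EuclideanSpace ℂ (Fin n))}
    (h : IsEigenbasis U θ ψ) (j : Fin n) {g : ℝ → ℂ} {K : NNReal}
    (hg : LipschitzWith K g) {C : ℝ} (hC : ∀ z, ‖g z‖ ≤ C) {T : ℕ} (hT : 0 < T)
    (hn : M₀ * slopeLcm S M₀ ^ T ∣ n) :
    ‖expectation g (ψ j) - expectation (timeAverage S g T) (ψ j)‖ ≤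
      T * (2 * K * slopeLcm S M₀ ^ T) / √n := by
  set L := slopeLcm S M₀ with hL
  have hL1 : (1 : ℝ) ≤ L := by
    have := hS.two_le_slopeLcm
    exact_mod_cast (by omega : 1 ≤ L)
  have hn0 : (0 : ℝ) < n := by exact_mod_cast j.pos
  have hTC : (T : ℂ) ≠ 0 := by exact_mod_cast hT.ne'
  set E : ℕ → ℂ := fun t => expectation (fun z => g (S^[t] z)) (ψ j) with hE
  set η : ℝ := 2 * K * L ^ T / √n with hη
  have hstep : ∀ t, t < T → ‖E t - E (t + 1)‖ ≤ η := by
    intro t ht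
    rw [hE]
    simp only [expectation_eq_diagMean]
    have hdvd : M₀ * L ^ (t + 1) ∣ n := (Nat.mul_dvd_mul_left _ (pow_dvd_pow _ ht)).trans hn
    refine (hU.norm_diagMean_sub_le h j (ε := 2 * (K * (L ^ (t + 1) / n))) (by positivity)
      fun x y hxy => hU.norm_atomMean_iterate_sub_le hS hg hC hdvd hxy).trans ?_
    calc 2 * (K * ((L : ℝ) ^ (t + 1) / n)) * √n = 2 * K * L ^ (t + 1) * (√n / n) := by ring
      _ = 2 * K * L ^ (t + 1) / √n := by rw [Real.sqrt_div_self']; ring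
      _ ≤ η := by
          rw [hη]; gcongr
          omega
  have hη0 : 0 ≤ η := by positivity
  have hE0 : ∀ t, t ≤ T → ‖E 0 - E t‖ ≤ t * η := by
    intro t
    induction t with
    | zero => simp
    | succ t ih =>
      intro ht
      have h1 := ih (by omega)
      have h2 := hstep t (by omega)
      calc ‖E 0 - E (t + 1)‖ = ‖(E 0 - E t) + (E t - E (t + 1))‖ := by congr 1; ring
        _ ≤ t * η + η := (norm_add_le _ _).trans (add_le_add h1 h2)
        _ = _ := by push_cast; ring
  have hmean : expectation (timeAverage S g T) (ψ j) = (T : ℂ)⁻¹ * ∑ t ∈ Finset.range T, E t := by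
    rw [hE]
    simp only [expectation_eq_diagMean, diagMean]
    rw [Finset.sum_comm, Finset.mul_sum]
    refine Finset.sum_congr rfl fun x _ => ?_
    rw [← Finset.sum_mul, ← mul_assoc]
    congr 1
    simp only [atomMean, timeAverage]
    rw [integral_const_mul, integral_finsetSum _ fun t _ =>
      (integrableOn_comp_iterate hS.measurable hg.continuous hC t).mono_set (atom_subset_Icc x),
      ← Finset.mul_sum]
    ring
  have hE00 : expectation g (ψ j) = E 0 := rfl
  rw [hE00, hmean]
  have : E 0 - (T : ℂ)⁻¹ * ∑ t ∈ Finset.range T, E t =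
      (T : ℂ)⁻¹ * ∑ t ∈ Finset.range T, (E 0 - E t) := by
    rw [Finset.sum_sub_distrib, Finset.sum_const, Finset.card_range, nsmul_eq_mul]
    field_simp
  rw [this, norm_mul, norm_inv, Complex.norm_natCast]
  have hTR : (0 : ℝ) < T := by exact_mod_cast hT
  calc (T : ℝ)⁻¹ * ‖∑ t ∈ Finset.range T, (E 0 - E t)‖
      ≤ (T : ℝ)⁻¹ * ∑ t ∈ Finset.range T, T * η := by
        gcongr
        refine (norm_sum_le _ _).trans (Finset.sum_le_sum fun t ht => ?_)
        have ht' := Finset.mem_range.1 ht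
        refine (hE0 t ht'.le).trans ?_
        gcongr
    _ = T * η := by rw [Finset.sum_const, Finset.card_range, nsmul_eq_mul]; field_simp
    _ = _ := by rw [hη]; ring

/-! ### Averages over a bin -/

lemma norm_timeAverage_le {S : ℝ → ℝ} {g : ℝ → ℂ} {C : ℝ} (hC : ∀ z, ‖g z‖ ≤ C) {T : ℕ}
    (hT : 0 < T) (z : ℝ) : ‖timeAverage S g T z‖ ≤ C := by
  have hTR : (0 : ℝ) < T := by exact_mod_cast hT
  rw [timeAverage, norm_mul, norm_inv, Complex.norm_natCast, inv_mul_le_iff₀ hTR]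
  refine (norm_sum_le _ _).trans ((Finset.sum_le_sum fun t _ => hC _).trans ?_)
  simp

lemma measurable_timeAverage {S : ℝ → ℝ} (hS : Measurable S) {g : ℝ → ℂ} (hg : Measurable g)
    (T : ℕ) : Measurable (timeAverage S g T) :=
  measurable_const.mul (Finset.measurable_sum _ fun t _ => hg.comp (hS.iterate t))

/-- The quantum variance in a bin is controlled by the classical variance of the time average, the
number of exceptional coordinates, and the error in the Egorov property. -/
lemma IsQuantization.bin_average_le {S : ℝ → ℝ} {M₀ n : ℕ} (hn0 : 0 < n)
    (hS : IsAdmissible S M₀) {U : Matrix (Fin n) (Fin n) ℂ} (hU : IsQuantization S n U)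
    {θ : Fin n → ℝ} {ψ : OrthonormalBasis (Fin n) ℂ (EuclideanSpace ℂ (Fin n))}
    (h : IsEigenbasis U θ ψ) {I : Set Real.Angle} {len : ℝ} (hI : IsArc I len) {R : ℕ}
    (hR : 6 * Real.pi ≤ R * len) (hbad : 2 * (recurrentSet U R).card ≤ n)
    {g : ℝ → ℂ} {K : NNReal}
    (hg : LipschitzWith K g) {C : ℝ} (hC : ∀ z, ‖g z‖ ≤ C) {T : ℕ} (hT : 0 < T)
    (hn : M₀ * slopeLcm S M₀ ^ T ∣ n) :
    1 / ((bin θ I).card : ℝ) * ∑ j ∈ bin θ I, ‖expectation g (ψ j)‖ ^ 2 ≤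
      96 * Real.pi * ∫ z, ‖timeAverage S g T z‖ ^ 2 ∂leb01 +
      48 * Real.pi * C ^ 2 * ((recurrentSet U R).card / (n * len)) +
      2 * (T * (2 * K * slopeLcm S M₀ ^ T) / √n) ^ 2 := by
  obtain ⟨hup, hlow⟩ := h.arc_bounds hI hR
    (bad := recurrentSet U R) fun x hx => pow_diag_eq_zero_of_notMem_recurrentSet hx
  have hπ := Real.pi_pos
  have hn0' : (0 : ℝ) < n := by exact_mod_cast hn0
  have hlen : 0 < len := by
    by_contra hcon
    nlinarith [mul_nonpos_of_nonneg_of_nonpos (Nat.cast_nonneg (α := ℝ) R) (not_lt.1 hcon)]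
  have hC0 : 0 ≤ C := (norm_nonneg _).trans (hC 0)
  set η : ℝ := T * (2 * K * slopeLcm S M₀ ^ T) / √n with hη
  set B := bin θ I
  set N := (recurrentSet U R).card
  set A := timeAverage S g T with hA
  set J := ∫ z, ‖A z‖ ^ 2 ∂leb01 with hJ
  have hb : (n : ℝ) * len / (24 * Real.pi) ≤ B.card := by
    refine le_trans ?_ hlow
    have : (2 : ℝ) * N ≤ n := by exact_mod_cast hbad
    calc (n : ℝ) * len / (24 * Real.pi) = (n - n / 2) * (len / (12 * Real.pi)) := by field_simp; ring
      _ ≤ _ := by gcongr; linarith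
  have hnl : 0 < (n : ℝ) * len / (24 * Real.pi) := by positivity
  have hb0 : (0 : ℝ) < B.card := hnl.trans_le hb
  have hAm : Measurable A := measurable_timeAverage hS.measurable hg.continuous.measurable T
  have hAC : ∀ z, ‖A z‖ ≤ C := norm_timeAverage_le hC hT
  have hint : IntegrableOn A (Icc 0 1) := Measure.integrableOn_of_bounded (M := C) (by simp)
    hAm.aestronglyMeasurable (Eventually.of_forall hAC)
  have hint2 : IntegrableOn (fun z => ‖A z‖ ^ 2) (Icc 0 1) :=
    Measure.integrableOn_of_bounded (M := C ^ 2) (by simp)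
      (hAm.norm.pow_const 2).aestronglyMeasurable (Eventually.of_forall fun z => by
        rw [Real.norm_of_nonneg (by positivity)]
        have := hAC z
        gcongr)
  have hJ0 : 0 ≤ J := integral_nonneg fun z => by positivity
  have hpt : ∀ j, ‖expectation g (ψ j)‖ ^ 2 ≤
      2 * ∑ x, ‖atomMean n A x‖ ^ 2 * ‖ψ j x‖ ^ 2 + 2 * η ^ 2 := by
    intro j
    have h1 := hU.norm_expectation_sub_timeAverage_le hS h j hg hC hT hn
    have h2 : ‖expectation g (ψ j)‖ ≤ ‖expectation A (ψ j)‖ + η := by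
      have := norm_le_norm_add_norm_sub' (expectation g (ψ j)) (expectation A (ψ j))
      linarith
    have h3 : ‖expectation A (ψ j)‖ ^ 2 ≤ ∑ x, ‖atomMean n A x‖ ^ 2 * ‖ψ j x‖ ^ 2 := by
      rw [expectation_eq_diagMean]
      exact norm_sq_diagMean_le _ (ψ.norm_eq_one j)
    calc ‖expectation g (ψ j)‖ ^ 2 ≤ (‖expectation A (ψ j)‖ + η) ^ 2 := by gcongr
      _ ≤ 2 * ‖expectation A (ψ j)‖ ^ 2 + 2 * η ^ 2 := by
          nlinarith [sq_nonneg (‖expectation A (ψ j)‖ - η)]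
      _ ≤ _ := by gcongr
  have hdouble : ∑ j ∈ B, ∑ x, ‖atomMean n A x‖ ^ 2 * ‖ψ j x‖ ^ 2 ≤
      2 * len * (n * J) + N * C ^ 2 := by
    rw [Finset.sum_comm]
    classical
    have hx : ∀ x, ∑ j ∈ B, ‖atomMean n A x‖ ^ 2 * ‖ψ j x‖ ^ 2 ≤
        2 * len * ‖atomMean n A x‖ ^ 2 + if x ∈ recurrentSet U R then C ^ 2 else 0 := by
      intro x
      rw [← Finset.mul_sum]
      by_cases hxb : x ∈ recurrentSet U R
      · rw [if_pos hxb]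
        have h1 : ‖atomMean n A x‖ ≤ C :=
          norm_atomMean_le (hint.mono_set (atom_subset_Icc x)) fun z _ => hAC z
        have h2 : ∑ j ∈ B, ‖ψ j x‖ ^ 2 ≤ 1 := by
          rw [← sum_norm_sq_eigenvectors ψ x]
          exact Finset.sum_le_sum_of_subset_of_nonneg (Finset.subset_univ _)
            fun _ _ _ => by positivity
        calc ‖atomMean n A x‖ ^ 2 * ∑ j ∈ B, ‖ψ j x‖ ^ 2 ≤ C ^ 2 * 1 := by gcongr
          _ ≤ _ := by rw [mul_one]; exact le_add_of_nonneg_left (by positivity)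
      · rw [if_neg hxb, add_zero, mul_comm]
        have := hup x hxb
        gcongr
    refine (Finset.sum_le_sum fun x _ => hx x).trans ?_
    rw [Finset.sum_add_distrib, ← Finset.mul_sum, Finset.sum_ite_mem, Finset.univ_inter,
      Finset.sum_const, nsmul_eq_mul]
    have := sum_norm_sq_atomMean_le (n := n) hint hint2
    gcongr
  have hsum : ∑ j ∈ B, ‖expectation g (ψ j)‖ ^ 2 ≤
      2 * (2 * len * (n * J) + N * C ^ 2) + B.card * (2 * η ^ 2) := by
    refine (Finset.sum_le_sum fun j _ => hpt j).trans ?_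
    rw [Finset.sum_add_distrib, ← Finset.mul_sum, Finset.sum_const, nsmul_eq_mul]
    gcongr
  calc 1 / (B.card : ℝ) * ∑ j ∈ B, ‖expectation g (ψ j)‖ ^ 2
      ≤ 1 / (B.card : ℝ) * (2 * (2 * len * (n * J) + N * C ^ 2) + B.card * (2 * η ^ 2)) := by gcongr
    _ = 1 / (B.card : ℝ) * (2 * (2 * len * (n * J) + N * C ^ 2)) + 2 * η ^ 2 := by field_simp
    _ ≤ 1 / ((n : ℝ) * len / (24 * Real.pi)) * (2 * (2 * len * (n * J) + N * C ^ 2)) +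
        2 * η ^ 2 := by gcongr
    _ = _ := by field_simp; ring

/-! ### Asymptotics of the dimensions -/

lemma IsAdmissible.dvd_of_le_Ktilde {S : ℝ → ℝ} {M₀ n T : ℕ} (h : M₀ ∣ n)
    (hT : T ≤ Ktilde S M₀ n) : M₀ * slopeLcm S M₀ ^ T ∣ n := by
  have h1 : slopeLcm S M₀ ^ T ∣ n / M₀ := (pow_dvd_pow _ hT).trans (pow_multiplicity_dvd _ _)
  obtain ⟨r, hr⟩ := h1
  exact ⟨r, by rw [mul_assoc, ← hr, Nat.mul_div_cancel' h]⟩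

lemma IsAdmissible.two_pow_Ktilde_le {S : ℝ → ℝ} {M₀ n : ℕ} (hS : IsAdmissible S M₀)
    (hn : 0 < n) (h : M₀ ∣ n) : 2 ^ Ktilde S M₀ n ≤ n := by
  have h1 := Nat.le_of_dvd hn (IsAdmissible.dvd_of_le_Ktilde (S := S) h le_rfl)
  have h2 := hS.two_le_slopeLcm
  have h3 := hS.pos
  calc 2 ^ Ktilde S M₀ n ≤ slopeLcm S M₀ ^ Ktilde S M₀ n := by gcongr
    _ ≤ M₀ * slopeLcm S M₀ ^ Ktilde S M₀ n := Nat.le_mul_of_pos_left _ h3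
    _ ≤ n := h1

/-- Up to the time `K̃ / (2 M₀)` there are at most `√n` branches of the iterates, so that few
coordinates are recurrent. -/
lemma IsQuantization.card_recurrentSet_le_sqrt {S : ℝ → ℝ} {M₀ n : ℕ} (hS : IsAdmissible S M₀)
    (hn0 : 0 < n) (hn : M₀ ∣ n) {U : Matrix (Fin n) (Fin n) ℂ} (hU : IsQuantization S n U) :
    ((recurrentSet U (Ktilde S M₀ n / (2 * M₀))).card : ℝ) ≤ 2 * Ktilde S M₀ n * √n := by
  set K := Ktilde S M₀ n with hK
  set R := K / (2 * M₀) with hR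
  have h1 : ((recurrentSet U R).card : ℝ) ≤ R * (M₀ ^ R * 2) := by
    exact_mod_cast hU.card_recurrentSet_le hS hn R
  have h2 : (M₀ ^ R) ^ 2 ≤ n := by
    calc (M₀ ^ R) ^ 2 ≤ ((2 ^ M₀) ^ R) ^ 2 := by
          gcongr
          exact Nat.lt_two_pow_self.le
      _ = 2 ^ (2 * M₀ * R) := by rw [← pow_mul, ← pow_mul]; congr 1; ring
      _ ≤ 2 ^ K := Nat.pow_le_pow_right (by norm_num) (Nat.mul_div_le _ _)
      _ ≤ n := hS.two_pow_Ktilde_le hn0 hn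
  have h3 : ((M₀ : ℝ) ^ R) ≤ √n := Real.le_sqrt_of_sq_le (by exact_mod_cast h2)
  have h4 : (R : ℝ) ≤ K := by exact_mod_cast Nat.div_le_self _ _
  calc ((recurrentSet U R).card : ℝ) ≤ R * (M₀ ^ R * 2) := h1
    _ ≤ K * (√n * 2) := by gcongr
    _ = _ := by ring

lemma tendsto_natCast_of_tendsto_Ktilde {S : ℝ → ℝ} {M₀ : ℕ} (hS : IsAdmissible S M₀) {n : ℕ → ℕ}
    (hn : ∀ k, 0 < n k ∧ M₀ ∣ n k)
    (hK : Tendsto (fun k => Ktilde S M₀ (n k)) atTop atTop) :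
    Tendsto (fun k => (n k : ℝ)) atTop atTop := by
  refine tendsto_natCast_atTop_atTop.comp (tendsto_atTop_mono (fun k => ?_) hK)
  exact Nat.lt_two_pow_self.le.trans (hS.two_pow_Ktilde_le (hn k).1 (hn k).2)

lemma eventually_le_div_mul_len {M₀ : ℕ} (hM : 0 < M₀) {K : ℕ → ℕ} {len : ℕ → ℝ}
    (hlen2 : ∀ k, len k ≤ 2 * Real.pi) (hlen0 : ∀ k, 0 ≤ len k)
    (hlen : Tendsto (fun k => len k * (K k : ℝ)) atTop atTop) :
    ∀ᶠ k in atTop, 6 * Real.pi ≤ ((K k / (2 * M₀) : ℕ) : ℝ) * len k := by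
  have hM' : (0 : ℝ) < M₀ := by exact_mod_cast hM
  filter_upwards [hlen.eventually_ge_atTop (8 * Real.pi * (2 * M₀))] with k hk
  have h1 : (K k : ℝ) / (2 * M₀) ≤ ((K k / (2 * M₀) : ℕ) : ℝ) + 1 := by
    have : K k < (K k / (2 * M₀) + 1) * (2 * M₀) := by
      have := Nat.lt_div_mul_add (a := K k) (b := 2 * M₀) (by omega)
      linarith
    rw [div_le_iff₀ (by positivity)]
    exact_mod_cast this.le
  have h2 : 8 * Real.pi ≤ (K k : ℝ) / (2 * M₀) * len k := by
    rw [div_mul_eq_mul_div, le_div_iff₀ (by positivity)]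
    linarith
  nlinarith [mul_le_mul_of_nonneg_right h1 (hlen0 k), hlen2 k]

lemma tendsto_card_recurrentSet_div {S : ℝ → ℝ} {M₀ : ℕ} (hS : IsAdmissible S M₀)
    {n : ℕ → ℕ} (hn : ∀ k, 0 < n k ∧ M₀ ∣ n k)
    (hK : Tendsto (fun k => Ktilde S M₀ (n k)) atTop atTop)
    {U : ∀ k, Matrix (Fin (n k)) (Fin (n k)) ℂ} (hU : ∀ k, IsQuantization S (n k) (U k))
    {len : ℕ → ℝ} (hlen : Tendsto (fun k => len k * (Ktilde S M₀ (n k) : ℝ)) atTop atTop) :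
    Tendsto (fun k => ((recurrentSet (U k) (Ktilde S M₀ (n k) / (2 * M₀))).card : ℝ) /
      (n k * len k)) atTop (𝓝 0) := by
  have hs2 : 1 < √(2 : ℝ) := by
    rw [Real.lt_sqrt (by norm_num)]; norm_num
  have hlim : Tendsto (fun k => 2 * ((Ktilde S M₀ (n k) : ℝ) ^ 2 / √2 ^ Ktilde S M₀ (n k)))
      atTop (𝓝 0) := by
    have := ((tendsto_pow_const_div_const_pow_of_one_lt 2 hs2).comp hK).const_mul 2
    simpa using this
  refine squeeze_zero' ?_ ?_ hlim
  · filter_upwards [hlen.eventually_ge_atTop 1] with k hk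
    have : 0 ≤ len k := by
      by_contra h
      nlinarith [mul_nonpos_of_nonpos_of_nonneg (not_le.1 h).le
        (Nat.cast_nonneg (α := ℝ) (Ktilde S M₀ (n k)))]
    positivity
  · filter_upwards [hlen.eventually_ge_atTop 1] with k hk
    set K : ℝ := ((Ktilde S M₀ (n k) : ℕ) : ℝ) with hKdef
    have hK0 : 0 ≤ K := Nat.cast_nonneg _
    have hl0 : 0 < len k := by
      by_contra h
      nlinarith [mul_nonpos_of_nonpos_of_nonneg (not_lt.1 h) hK0]
    have hn0 : (0 : ℝ) < n k := by exact_mod_cast (hn k).1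
    have h1 := (hU k).card_recurrentSet_le_sqrt hS (hn k).1 (hn k).2
    have h2 : √2 ^ Ktilde S M₀ (n k) ≤ √(n k : ℝ) := by
      refine Real.le_sqrt_of_sq_le ?_
      rw [← pow_mul, mul_comm, pow_mul, Real.sq_sqrt (by norm_num)]
      exact_mod_cast hS.two_pow_Ktilde_le (hn k).1 (hn k).2
    have hinv : 1 / len k ≤ K := by
      rw [div_le_iff₀ hl0]; linarith
    calc ((recurrentSet (U k) (Ktilde S M₀ (n k) / (2 * M₀))).card : ℝ) / (n k * len k)
        ≤ 2 * K * √(n k) / (n k * len k) := by gcongr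
      _ = 2 * K * (√(n k) / n k) * (1 / len k) := by field_simp
      _ = 2 * K * (1 / √(n k)) * (1 / len k) := by rw [Real.sqrt_div_self']
      _ ≤ 2 * K * (1 / √2 ^ Ktilde S M₀ (n k)) * K := by gcongr
      _ = _ := by ring

lemma eventually_two_mul_card_recurrentSet_le {S : ℝ → ℝ} {M₀ : ℕ} (hS : IsAdmissible S M₀)
    {n : ℕ → ℕ} (hn : ∀ k, 0 < n k ∧ M₀ ∣ n k)
    (hK : Tendsto (fun k => Ktilde S M₀ (n k)) atTop atTop)
    {U : ∀ k, Matrix (Fin (n k)) (Fin (n k)) ℂ} (hU : ∀ k, IsQuantization S (n k) (U k)) :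
    ∀ᶠ k in atTop, 2 * (recurrentSet (U k) (Ktilde S M₀ (n k) / (2 * M₀))).card ≤ n k := by
  have h := tendsto_card_recurrentSet_div hS hn hK hU (len := fun _ => 1)
    (by simpa [Function.comp_def] using tendsto_natCast_atTop_atTop.comp hK)
  filter_upwards [h.eventually_lt_const (by norm_num : (0 : ℝ) < 1 / 2)] with k hk
  have hn0 : (0 : ℝ) < n k := by exact_mod_cast (hn k).1
  rw [mul_one, div_lt_iff₀ hn0] at hk
  have : (2 : ℝ) * (recurrentSet (U k) (Ktilde S M₀ (n k) / (2 * M₀))).card ≤ n k := by linarith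
  exact_mod_cast this

/-! ### Decay of the quantum variance -/

instance : IsProbabilityMeasure leb01 := ⟨by simp [leb01]⟩

lemma tendsto_bin_average_of_integral_eq_zero
    {S : ℝ → ℝ} {M₀ : ℕ} (hS : IsAdmissible S M₀) (herg : Ergodic S leb01)
    {n : ℕ → ℕ} (hn : ∀ k, 0 < n k ∧ M₀ ∣ n k)
    (hK : Tendsto (fun k => Ktilde S M₀ (n k)) atTop atTop)
    {U : ∀ k, Matrix (Fin (n k)) (Fin (n k)) ℂ} (hU : ∀ k, IsQuantization S (n k) (U k))
    {θ : ∀ k, Fin (n k) → ℝ}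
    {ψ : ∀ k, OrthonormalBasis (Fin (n k)) ℂ (EuclideanSpace ℂ (Fin (n k)))}
    (hψ : ∀ k, IsEigenbasis (U k) (θ k) (ψ k))
    {I : ℕ → Set Real.Angle} {len : ℕ → ℝ} (hI : ∀ k, IsArc (I k) (len k))
    (hlen : Tendsto (fun k => len k * (Ktilde S M₀ (n k) : ℝ)) atTop atTop)
    {g : ℝ → ℂ} {K : NNReal} (hg : LipschitzWith K g) {C : ℝ} (hC : ∀ z, ‖g z‖ ≤ C)
    (h0 : ∫ z, g z ∂leb01 = 0) :
    Tendsto (fun k => 1 / ((bin (θ k) (I k)).card : ℝ) *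
      ∑ j ∈ bin (θ k) (I k), ‖expectation g (ψ k j)‖ ^ 2) atTop (𝓝 0) := by
  have hgL : MemLp g 2 leb01 := MemLp.of_bound hg.continuous.aestronglyMeasurable C
    (Eventually.of_forall hC)
  have hmean := (tendsto_integral_norm_sq_birkhoff herg hgL h0).const_mul (96 * Real.pi)
  rw [mul_zero] at hmean
  rw [Metric.tendsto_nhds]
  intro ε hε
  obtain ⟨T, hT, hT0⟩ := ((hmean.eventually_lt_const (half_pos hε)).and
    (eventually_gt_atTop 0)).exists
  have hnR := tendsto_natCast_of_tendsto_Ktilde hS hn hK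
  have hlim : Tendsto (fun k => 96 * Real.pi * ∫ z, ‖timeAverage S g T z‖ ^ 2 ∂leb01 +
      48 * Real.pi * C ^ 2 * ((recurrentSet (U k) (Ktilde S M₀ (n k) / (2 * M₀))).card /
        (n k * len k)) +
      2 * (T * (2 * K * slopeLcm S M₀ ^ T) / √(n k)) ^ 2) atTop
      (𝓝 (96 * Real.pi * ∫ z, ‖timeAverage S g T z‖ ^ 2 ∂leb01 + 48 * Real.pi * C ^ 2 * 0 +
        2 * 0 ^ 2)) := by
    refine (tendsto_const_nhds.add
      ((tendsto_card_recurrentSet_div hS hn hK hU hlen).const_mul _)).add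
      (Tendsto.const_mul _ (Tendsto.pow ?_ 2))
    exact tendsto_const_nhds.div_atTop (Real.tendsto_sqrt_atTop.comp hnR)
  have hlt : 96 * Real.pi * ∫ z, ‖timeAverage S g T z‖ ^ 2 ∂leb01 + 48 * Real.pi * C ^ 2 * 0 +
      2 * 0 ^ 2 < ε := by
    change 96 * Real.pi * ∫ z, ‖timeAverage S g T z‖ ^ 2 ∂leb01 < ε / 2 at hT
    linarith
  filter_upwards [hlim.eventually_lt_const hlt,
    eventually_two_mul_card_recurrentSet_le hS hn hK hU,
    eventually_le_div_mul_len hS.pos (fun k => (hI k).2.1) (fun k => (hI k).1) hlen,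
    hK.eventually_ge_atTop T] with k h1 h2 h3 h4
  have h5 := (hU k).bin_average_le (hn k).1 hS (hψ k) (hI k) h3 h2 hg hC hT0
    (IsAdmissible.dvd_of_le_Ktilde (hn k).2 h4)
  rw [Real.dist_eq, sub_zero, abs_of_nonneg]
  · exact h5.trans_lt h1
  · exact mul_nonneg (by positivity) (Finset.sum_nonneg fun j _ => by positivity)

lemma eventually_bin_nonempty
    {S : ℝ → ℝ} {M₀ : ℕ} (hS : IsAdmissible S M₀)
    {n : ℕ → ℕ} (hn : ∀ k, 0 < n k ∧ M₀ ∣ n k)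
    (hK : Tendsto (fun k => Ktilde S M₀ (n k)) atTop atTop)
    {U : ∀ k, Matrix (Fin (n k)) (Fin (n k)) ℂ} (hU : ∀ k, IsQuantization S (n k) (U k))
    {θ : ∀ k, Fin (n k) → ℝ}
    {ψ : ∀ k, OrthonormalBasis (Fin (n k)) ℂ (EuclideanSpace ℂ (Fin (n k)))}
    (hψ : ∀ k, IsEigenbasis (U k) (θ k) (ψ k))
    {I : ℕ → Set Real.Angle} {len : ℕ → ℝ} (hI : ∀ k, IsArc (I k) (len k))
    (hlen : Tendsto (fun k => len k * (Ktilde S M₀ (n k) : ℝ)) atTop atTop) :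
    ∀ᶠ k in atTop, (bin (θ k) (I k)).Nonempty := by
  filter_upwards [eventually_two_mul_card_recurrentSet_le hS hn hK hU,
    eventually_le_div_mul_len hS.pos (fun k => (hI k).2.1) (fun k => (hI k).1) hlen] with k h2 h3
  have hπ := Real.pi_pos
  have h1 := ((hψ k).arc_bounds (hI k) h3 (bad := recurrentSet (U k) _)
    fun x hx => pow_diag_eq_zero_of_notMem_recurrentSet hx).2
  have hn0 : (0 : ℝ) < n k := by exact_mod_cast (hn k).1
  have hl0 : 0 < len k := by
    rcases (hI k).1.lt_or_eq with h | h
    · exact h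
    · rw [← h, mul_zero] at h3; linarith
  have h2' : (2 : ℝ) * (recurrentSet (U k) (Ktilde S M₀ (n k) / (2 * M₀))).card ≤ n k := by
    exact_mod_cast h2
  rw [← Finset.card_pos]
  have : (0 : ℝ) < (bin (θ k) (I k)).card :=
    lt_of_lt_of_le (mul_pos (by linarith) (by positivity)) h1
  exact_mod_cast this

/-! ### Linearity and boundedness of expectations -/

lemma diagMean_one {n : ℕ} {ψ : EuclideanSpace ℂ (Fin n)} (hψ : ‖ψ‖ = 1) :
    ∑ x, ((‖ψ x‖ ^ 2 : ℝ) : ℂ) = 1 := by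
  rw [← Complex.ofReal_sum, ← EuclideanSpace.norm_sq_eq, hψ]; simp

lemma expectation_congr {n : ℕ} {h h' : ℝ → ℂ} (ψ : EuclideanSpace ℂ (Fin n))
    (H : ∀ z ∈ Icc (0 : ℝ) 1, h z = h' z) : expectation h ψ = expectation h' ψ := by
  rw [expectation_eq_diagMean, expectation_eq_diagMean, diagMean, diagMean]
  exact Finset.sum_congr rfl fun x _ => by
    rw [atomMean_congr fun z hz => H z (atom_subset_Icc x hz)]

lemma expectation_sub {n : ℕ} {h h' : ℝ → ℂ} (ψ : EuclideanSpace ℂ (Fin n))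
    (hi : IntegrableOn h (Icc 0 1)) (hi' : IntegrableOn h' (Icc 0 1)) :
    expectation (fun z => h z - h' z) ψ = expectation h ψ - expectation h' ψ := by
  simp only [expectation_eq_diagMean, diagMean, ← Finset.sum_sub_distrib, ← sub_mul, atomMean,
    ← mul_sub]
  refine Finset.sum_congr rfl fun x _ => ?_
  rw [integral_sub (hi.mono_set (atom_subset_Icc x)) (hi'.mono_set (atom_subset_Icc x))]

lemma expectation_sum_const_mul {n : ℕ} {ι : Type*} (s : Finset ι) (a : ι → ℂ) {h : ι → ℝ → ℂ}
    (ψ : EuclideanSpace ℂ (Fin n)) (hi : ∀ i ∈ s, IntegrableOn (h i) (Icc 0 1)) :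
    expectation (fun z => ∑ i ∈ s, a i * h i z) ψ = ∑ i ∈ s, a i * expectation (h i) ψ := by
  simp only [expectation_eq_diagMean, diagMean, Finset.mul_sum]
  rw [Finset.sum_comm]
  refine Finset.sum_congr rfl fun x _ => ?_
  simp only [atomMean]
  rw [integral_finsetSum _ fun i hi' => ((hi i hi').mono_set (atom_subset_Icc x)).const_mul _,
    Finset.mul_sum, Finset.sum_mul]
  refine Finset.sum_congr rfl fun i _ => ?_
  rw [integral_const_mul]; ring

lemma norm_expectation_sub_const_le {n : ℕ} {h : ℝ → ℂ} {ψ : EuclideanSpace ℂ (Fin n)}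
    (hψ : ‖ψ‖ = 1) (hi : IntegrableOn h (Icc 0 1)) {c : ℂ} {C : ℝ}
    (hC : ∀ z ∈ Icc (0 : ℝ) 1, ‖h z - c‖ ≤ C) : ‖expectation h ψ - c‖ ≤ C := by
  have h1 : expectation h ψ - c = ∑ x, (atomMean n h x - c) * ((‖ψ x‖ ^ 2 : ℝ) : ℂ) := by
    simp only [sub_mul]
    rw [Finset.sum_sub_distrib, ← Finset.mul_sum, diagMean_one hψ, mul_one,
      expectation_eq_diagMean, diagMean]
  rw [h1]
  calc _ ≤ ∑ x, C * ‖ψ x‖ ^ 2 := by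
        refine (norm_sum_le _ _).trans (Finset.sum_le_sum fun x _ => ?_)
        rw [norm_mul, Complex.norm_real, Real.norm_of_nonneg (by positivity)]
        have := norm_atomMean_sub_le (hi.mono_set (atom_subset_Icc x)) (v := c) (ε := C)
          fun z hz => hC z (atom_subset_Icc x hz)
        gcongr
    _ = C := by
        rw [← Finset.mul_sum, ← EuclideanSpace.norm_sq_eq, hψ]; simp

lemma norm_expectation_le {n : ℕ} {h : ℝ → ℂ} {ψ : EuclideanSpace ℂ (Fin n)}
    (hψ : ‖ψ‖ = 1) (hi : IntegrableOn h (Icc 0 1)) {C : ℝ}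
    (hC : ∀ z ∈ Icc (0 : ℝ) 1, ‖h z‖ ≤ C) : ‖expectation h ψ‖ ≤ C := by
  simpa using norm_expectation_sub_const_le hψ hi (c := 0) (by simpa using hC)

lemma integral_leb01 (h : ℝ → ℂ) : ∫ z, h z ∂leb01 = ∫ z in (0 : ℝ)..1, h z := by
  rw [intervalIntegral.integral_of_le zero_le_one, leb01, integral_Icc_eq_integral_Ioc]

/-- Quantum variances of Lipschitz observables in a bin tend to zero. -/
lemma tendsto_bin_average
    {S : ℝ → ℝ} {M₀ : ℕ} (hS : IsAdmissible S M₀) (herg : Ergodic S leb01)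
    {n : ℕ → ℕ} (hn : ∀ k, 0 < n k ∧ M₀ ∣ n k)
    (hK : Tendsto (fun k => Ktilde S M₀ (n k)) atTop atTop)
    {U : ∀ k, Matrix (Fin (n k)) (Fin (n k)) ℂ} (hU : ∀ k, IsQuantization S (n k) (U k))
    {θ : ∀ k, Fin (n k) → ℝ}
    {ψ : ∀ k, OrthonormalBasis (Fin (n k)) ℂ (EuclideanSpace ℂ (Fin (n k)))}
    (hψ : ∀ k, IsEigenbasis (U k) (θ k) (ψ k))
    {I : ℕ → Set Real.Angle} {len : ℕ → ℝ} (hI : ∀ k, IsArc (I k) (len k))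
    (hlen : Tendsto (fun k => len k * (Ktilde S M₀ (n k) : ℝ)) atTop atTop)
    {h : ℝ → ℂ} {K : NNReal} (hh : LipschitzOnWith K h (Icc 0 1)) :
    Tendsto (fun k => (1 / ((bin (θ k) (I k)).card : ℝ)) *
          ∑ j ∈ bin (θ k) (I k), ‖expectation h (ψ k j) - ∫ z in (0 : ℝ)..1, h z‖ ^ 2)
        atTop (𝓝 0) := by
  set c := ∫ z in (0 : ℝ)..1, h z with hc
  -- extend `h` to a bounded Lipschitz function on `ℝ` and subtract the mean
  set g : ℝ → ℂ := fun z => h (projIcc (0 : ℝ) 1 zero_le_one z) - c with hg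
  have hgL : LipschitzWith K g := by
    have h1 := (lipschitzOnWith_iff_restrict.1 hh).comp
      (LipschitzWith.projIcc (zero_le_one (α := ℝ)))
    rw [mul_one] at h1
    have := h1.sub (LipschitzWith.const c)
    rwa [add_zero] at this
  have hgh : ∀ z ∈ Icc (0 : ℝ) 1, g z = h z - c := by
    intro z hz
    simp only [hg, projIcc_of_mem _ hz]
  obtain ⟨C, hC⟩ := isCompact_Icc.exists_bound_of_continuousOn
    (hgL.continuous.continuousOn (s := Icc (0 : ℝ) 1))
  have hC' : ∀ z, ‖g z‖ ≤ C := by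
    intro z
    have h1 := hC _ (projIcc (0 : ℝ) 1 zero_le_one z).2
    have h2 : g (projIcc (0 : ℝ) 1 zero_le_one z) = g z := by
      simp only [hg, projIcc_val]
    rwa [h2] at h1
  have hint : IntegrableOn h (Icc 0 1) := hh.continuousOn.integrableOn_Icc
  have h0 : ∫ z, g z ∂leb01 = 0 := by
    have : ∫ z, g z ∂leb01 = ∫ z, (h z - c) ∂leb01 :=
      setIntegral_congr_fun measurableSet_Icc hgh
    rw [this, integral_sub (μ := leb01) hint (integrable_const c), integral_leb01, integral_const]
    simp [hc]
  refine (tendsto_bin_average_of_integral_eq_zero hS herg hn hK hU hψ hI hlen hgL hC' h0).congr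
    fun k => ?_
  congr 1
  refine Finset.sum_congr rfl fun j _ => ?_
  have h1 : expectation g (ψ k j) = expectation h (ψ k j) - c := by
    rw [expectation_congr _ hgh, expectation_sub _ hint (integrableOn_const (by simp))]
    congr 1
    have := norm_expectation_sub_const_le (h := fun _ => c) (c := c) (C := 0)
      ((ψ k).norm_eq_one j) (integrableOn_const (by simp)) (by simp)
    exact sub_eq_zero.1 (norm_le_zero_iff.1 this)
  rw [h1]

/-! ### Subsets of full density -/

/-- If countably many uniformly bounded nonnegative functions on finite sets `B k` have averages
tending to zero, then they tend to zero uniformly on subsets of `B k` of asymptotically full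
proportion: apply Chebyshev's inequality to the weighted sum `∑ d, 2⁻ᵈ f d`. -/
lemma exists_full_density_subsets {ι : ℕ → Type*} (B : ∀ k, Finset (ι k))
    (hB : ∀ᶠ k in atTop, (B k).Nonempty) (f : ℕ → ∀ k, ι k → ℝ) {C : ℝ}
    (h0 : ∀ d k j, 0 ≤ f d k j) (h1 : ∀ d k j, f d k j ≤ C)
    (hf : ∀ d, Tendsto (fun k => 1 / ((B k).card : ℝ) * ∑ j ∈ B k, f d k j) atTop (𝓝 0)) :
    ∃ Λ : ∀ k, Finset (ι k), (∀ k, Λ k ⊆ B k) ∧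
      Tendsto (fun k => ((Λ k).card : ℝ) / ((B k).card : ℝ)) atTop (𝓝 1) ∧
      ∀ d, ∀ j : ∀ k, ι k, (∀ᶠ k in atTop, j k ∈ Λ k) →
        Tendsto (fun k => f d k (j k)) atTop (𝓝 0) := by
  classical
  have hgeo : Summable fun d : ℕ => (1 / 2 : ℝ) ^ d * C := summable_geometric_two.mul_right C
  have hsum : ∀ k j, Summable fun d => (1 / 2 : ℝ) ^ d * f d k j := fun k j =>
    Summable.of_nonneg_of_le (fun d => mul_nonneg (by positivity) (h0 d k j))
      (fun d => mul_le_mul_of_nonneg_left (h1 d k j) (by positivity)) hgeo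
  set F : ∀ k, ι k → ℝ := fun k j => ∑' d, (1 / 2 : ℝ) ^ d * f d k j with hF
  have hF0 : ∀ k j, 0 ≤ F k j := fun k j =>
    tsum_nonneg fun d => mul_nonneg (by positivity) (h0 d k j)
  set a : ℕ → ℝ := fun k => ∑' d, (1 / 2 : ℝ) ^ d *
    (1 / ((B k).card : ℝ) * ∑ j ∈ B k, f d k j) with ha
  have haF : ∀ k, a k = 1 / ((B k).card : ℝ) * ∑ j ∈ B k, F k j := by
    intro k
    simp only [ha, hF]
    rw [← Summable.tsum_finsetSum fun j _ => hsum k j, ← tsum_mul_left]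
    refine tsum_congr fun d => ?_
    rw [← Finset.mul_sum]; ring
  have ha0 : ∀ k, 0 ≤ a k := fun k => by
    rw [haF]
    exact mul_nonneg (by positivity) (Finset.sum_nonneg fun j _ => hF0 k j)
  have halim : Tendsto a atTop (𝓝 0) := by
    have := tendsto_tsum_of_dominated_convergence (𝓕 := atTop)
      (f := fun k d => (1 / 2 : ℝ) ^ d * (1 / ((B k).card : ℝ) * ∑ j ∈ B k, f d k j))
      (g := fun d => (1 / 2 : ℝ) ^ d * 0) hgeo (fun d => (hf d).const_mul _) ?_
    · simpa only [mul_zero, tsum_zero] using this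
    · filter_upwards [hB] with k hk d
      have hcard : (0 : ℝ) < (B k).card := by exact_mod_cast hk.card_pos
      have hnn : 0 ≤ ∑ j ∈ B k, f d k j := Finset.sum_nonneg fun j _ => h0 d k j
      rw [Real.norm_of_nonneg (by positivity)]
      refine mul_le_mul_of_nonneg_left ?_ (by positivity)
      rw [div_mul_eq_mul_div, one_mul, div_le_iff₀ hcard, mul_comm C]
      refine (Finset.sum_le_sum fun j _ => h1 d k j).trans ?_
      simp
  -- the threshold; the second summand keeps it positive when all functions vanish on `B k`
  set τ : ℕ → ℝ := fun k => √(a k) + 1 / ((k : ℝ) + 1) with hτ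
  have hτ0 : ∀ k, 0 < τ k := fun k => by positivity
  have hsqrt : Tendsto (fun k => √(a k)) atTop (𝓝 0) := by simpa using halim.sqrt
  have hτlim : Tendsto τ atTop (𝓝 0) := by
    simpa only [add_zero] using hsqrt.add (tendsto_one_div_add_atTop_nhds_zero_nat (𝕜 := ℝ))
  refine ⟨fun k => (B k).filter fun j => F k j ≤ τ k, fun k => Finset.filter_subset _ _, ?_, ?_⟩
  · have hlow : ∀ᶠ k in atTop, 1 - √(a k) ≤
        (((B k).filter fun j => F k j ≤ τ k).card : ℝ) / ((B k).card : ℝ) := by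
      filter_upwards [hB] with k hk
      have hcard : (0 : ℝ) < (B k).card := by exact_mod_cast hk.card_pos
      have h2 : (((B k).filter fun j => ¬ F k j ≤ τ k).card : ℝ) * τ k ≤ (B k).card * a k := by
        calc (((B k).filter fun j => ¬ F k j ≤ τ k).card : ℝ) * τ k
            = ∑ j ∈ (B k).filter fun j => ¬ F k j ≤ τ k, τ k := by
              rw [Finset.sum_const, nsmul_eq_mul]
          _ ≤ ∑ j ∈ (B k).filter fun j => ¬ F k j ≤ τ k, F k j :=
              Finset.sum_le_sum fun j hj => (not_le.1 (Finset.mem_filter.1 hj).2).le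
          _ ≤ ∑ j ∈ B k, F k j := Finset.sum_le_sum_of_subset_of_nonneg (Finset.filter_subset _ _)
              fun j _ _ => hF0 k j
          _ = (B k).card * a k := by rw [haF]; field_simp
      have h3 : a k ≤ √(a k) * τ k := by
        have := Real.mul_self_sqrt (ha0 k)
        have h4 : 0 ≤ √(a k) * (1 / ((k : ℝ) + 1)) := by positivity
        rw [hτ]; simp only; nlinarith
      have h5 : (((B k).filter fun j => ¬ F k j ≤ τ k).card : ℝ) ≤ (B k).card * √(a k) := by
        refine le_of_mul_le_mul_right ?_ (hτ0 k)
        calc _ ≤ (B k).card * a k := h2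
          _ ≤ (B k).card * (√(a k) * τ k) := by gcongr
          _ = _ := by ring
      have h6 : (((B k).filter fun j => F k j ≤ τ k).card : ℝ) +
          ((B k).filter fun j => ¬ F k j ≤ τ k).card = (B k).card := by
        exact_mod_cast Finset.card_filter_add_card_filter_not (s := B k) (fun j => F k j ≤ τ k)
      rw [le_div_iff₀ hcard]
      linarith
    have hlim1 : Tendsto (fun k => 1 - √(a k)) atTop (𝓝 1) := by
      simpa using hsqrt.const_sub 1
    refine tendsto_of_tendsto_of_tendsto_of_le_of_le' hlim1 tendsto_const_nhds hlow ?_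
    refine Eventually.of_forall fun k => div_le_one_of_le₀ ?_ (by positivity)
    exact_mod_cast Finset.card_filter_le _ _
  · intro d j hj
    have hlim2 : Tendsto (fun k => 2 ^ d * τ k) atTop (𝓝 0) := by
      simpa using hτlim.const_mul ((2 : ℝ) ^ d)
    refine squeeze_zero' (Eventually.of_forall fun k => h0 d k _) ?_ hlim2
    filter_upwards [hj] with k hk
    have h2 : (1 / 2 : ℝ) ^ d * f d k (j k) ≤ τ k :=
      ((hsum k (j k)).le_tsum d fun i _ => mul_nonneg (by positivity) (h0 i k _)).trans
        (Finset.mem_filter.1 hk).2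
    calc f d k (j k) = 2 ^ d * ((1 / 2 : ℝ) ^ d * f d k (j k)) := by
          rw [← mul_assoc, ← mul_pow]; norm_num
      _ ≤ 2 ^ d * τ k := by gcongr

/-! ### Polynomial approximation -/

lemma exists_complex_polynomial_near {h : ℝ → ℂ} (hh : ContinuousOn h (Icc 0 1)) {ε : ℝ}
    (hε : 0 < ε) : ∃ P : Polynomial ℂ, ∀ z ∈ Icc (0 : ℝ) 1, ‖h z - P.eval (z : ℂ)‖ ≤ ε := by
  obtain ⟨p, hp⟩ := exists_polynomial_near_of_continuousOn 0 1 (fun z => (h z).re)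
    (Complex.continuous_re.comp_continuousOn hh) (ε / 2) (half_pos hε)
  obtain ⟨q, hq⟩ := exists_polynomial_near_of_continuousOn 0 1 (fun z => (h z).im)
    (Complex.continuous_im.comp_continuousOn hh) (ε / 2) (half_pos hε)
  refine ⟨p.map Complex.ofRealHom + Polynomial.C Complex.I * q.map Complex.ofRealHom,
    fun z hz => ?_⟩
  have e : ∀ r : Polynomial ℝ, (r.map Complex.ofRealHom).eval (z : ℂ) = ((r.eval z : ℝ) : ℂ) :=
    fun r => Polynomial.eval_map_apply Complex.ofRealHom z
  rw [Polynomial.eval_add, Polynomial.eval_mul, Polynomial.eval_C, e, e]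
  refine (Complex.norm_le_abs_re_add_abs_im _).trans ?_
  have h1 := hp z hz
  have h2 := hq z hz
  rw [abs_sub_comm] at h1 h2
  simp only [Complex.sub_re, Complex.sub_im, Complex.add_re, Complex.add_im, Complex.ofReal_re,
    Complex.ofReal_im, Complex.mul_re, Complex.mul_im, Complex.I_re, Complex.I_im, zero_mul,
    one_mul, mul_zero, zero_add, add_zero, sub_zero]
  linarith

lemma continuous_monomial (d : ℕ) : Continuous fun z : ℝ => (z : ℂ) ^ d := by fun_prop

/-- Convergence of the expectations of all monomials implies convergence of the expectations of
all continuous observables. -/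
lemma tendsto_expectation_of_monomials {n : ℕ → ℕ} {φ : ∀ k, EuclideanSpace ℂ (Fin (n k))}
    (hφ : ∀ k, ‖φ k‖ = 1)
    (hmono : ∀ d : ℕ, Tendsto (fun k => expectation (fun z : ℝ => (z : ℂ) ^ d) (φ k)) atTop
      (𝓝 (∫ z in (0 : ℝ)..1, (z : ℂ) ^ d)))
    {h : ℝ → ℂ} (hh : ContinuousOn h (Icc 0 1)) :
    Tendsto (fun k => expectation h (φ k)) atTop (𝓝 (∫ z in (0 : ℝ)..1, h z)) := by
  have hmi : ∀ d : ℕ, IntegrableOn (fun z : ℝ => (z : ℂ) ^ d) (Icc 0 1) := fun d =>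
    (continuous_monomial d).continuousOn.integrableOn_Icc
  have hpoly : ∀ P : Polynomial ℂ, Tendsto (fun k => expectation (fun z : ℝ => P.eval (z : ℂ)) (φ k))
      atTop (𝓝 (∫ z in (0 : ℝ)..1, P.eval (z : ℂ))) := by
    intro P
    simp only [Polynomial.eval_eq_sum_range]
    rw [intervalIntegral.integral_finsetSum fun d _ =>
      ((continuous_monomial d).const_mul _).intervalIntegrable _ _]
    simp only [expectation_sum_const_mul _ _ _ fun d _ => hmi d,
      intervalIntegral.integral_const_mul]
    exact tendsto_finsetSum _ fun d _ => (hmono d).const_mul _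
  have hi : IntegrableOn h (Icc 0 1) := hh.integrableOn_Icc
  rw [Metric.tendsto_nhds]
  intro ε hε
  obtain ⟨P, hP⟩ := exists_complex_polynomial_near hh (ε := ε / 4) (by positivity)
  have hPc : Continuous fun z : ℝ => P.eval (z : ℂ) := P.continuous.comp Complex.continuous_ofReal
  have hPi : IntegrableOn (fun z : ℝ => P.eval (z : ℂ)) (Icc 0 1) := hPc.continuousOn.integrableOn_Icc
  have hint : ‖(∫ z in (0 : ℝ)..1, h z) - ∫ z in (0 : ℝ)..1, P.eval (z : ℂ)‖ ≤ ε / 4 := by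
    rw [← intervalIntegral.integral_sub]
    · have := intervalIntegral.norm_integral_le_of_norm_le_const (a := 0) (b := 1) (C := ε / 4)
        (f := fun z : ℝ => h z - P.eval (z : ℂ)) fun z hz => hP z (by
          rw [uIoc_of_le zero_le_one] at hz; exact Ioc_subset_Icc_self hz)
      simpa using this
    · exact (intervalIntegrable_iff_integrableOn_Icc_of_le zero_le_one).2 hi
    · exact hPc.intervalIntegrable _ _
  filter_upwards [Metric.tendsto_nhds.1 (hpoly P) (ε / 4) (by positivity)] with k hk
  have hexp : ‖expectation h (φ k) - expectation (fun z : ℝ => P.eval (z : ℂ)) (φ k)‖ ≤ ε / 4 := by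
    rw [← expectation_sub _ hi hPi]
    exact norm_expectation_le (hφ k) (hi.sub hPi) hP
  rw [dist_eq_norm] at hk ⊢
  rw [norm_sub_rev] at hint
  set A := expectation h (φ k)
  set A' := expectation (fun z : ℝ => P.eval (z : ℂ)) (φ k)
  set J := ∫ z in (0 : ℝ)..1, h z
  set J' := ∫ z in (0 : ℝ)..1, P.eval (z : ℂ)
  calc ‖A - J‖ = ‖(A - A') + (A' - J') + (J' - J)‖ := by congr 1; ring
    _ ≤ ‖A - A'‖ + ‖A' - J'‖ + ‖J' - J‖ := norm_add₃_le
    _ < ε := by linarith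

lemma exists_lipschitzOnWith_monomial (d : ℕ) :
    ∃ K, LipschitzOnWith K (fun z : ℝ => (z : ℂ) ^ d) (Icc 0 1) := by
  have hc : ContDiff ℝ 1 fun z : ℝ => (z : ℂ) ^ d := Complex.ofRealCLM.contDiff.pow d
  exact (hc.locallyLipschitz.locallyLipschitzOn).exists_lipschitzOnWith_of_compact isCompact_Icc

end IntervalMap

theorem theorem2p4
    (S : ℝ → ℝ) (M₀ : ℕ) (hS : IsAdmissible S M₀) (herg : Ergodic S leb01)
    (n : ℕ → ℕ) (hn : ∀ k, 0 < n k ∧ M₀ ∣ n k)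
    (hK : Tendsto (fun k => Ktilde S M₀ (n k)) atTop atTop)
    (U : ∀ k, Matrix (Fin (n k)) (Fin (n k)) ℂ) (hU : ∀ k, IsQuantization S (n k) (U k))
    (θ : ∀ k, Fin (n k) → ℝ)
    (ψ : ∀ k, OrthonormalBasis (Fin (n k)) ℂ (EuclideanSpace ℂ (Fin (n k))))
    (hψ : ∀ k, IsEigenbasis (U k) (θ k) (ψ k))
    (I : ℕ → Set Real.Angle) (len : ℕ → ℝ) (hI : ∀ k, IsArc (I k) (len k))
    (hlen : Tendsto (fun k => len k * (Ktilde S M₀ (n k) : ℝ)) atTop atTop) :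
    (∀ᶠ k in atTop, (bin (θ k) (I k)).Nonempty) ∧
    (∀ h : ℝ → ℂ, (∃ C, LipschitzOnWith C h (Icc 0 1)) →
      Tendsto (fun k => (1 / ((bin (θ k) (I k)).card : ℝ)) *
          ∑ j ∈ bin (θ k) (I k), ‖expectation h (ψ k j) - ∫ z in (0 : ℝ)..1, h z‖ ^ 2)
        atTop (𝓝 0)) ∧
    (∃ Λ : ∀ k, Finset (Fin (n k)),
      (∀ k, Λ k ⊆ bin (θ k) (I k)) ∧
      Tendsto (fun k => ((Λ k).card : ℝ) / ((bin (θ k) (I k)).card : ℝ)) atTop (𝓝 1) ∧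
      ∀ h : ℝ → ℂ, ContinuousOn h (Icc 0 1) →
        ∀ j : ∀ k, Fin (n k), (∀ᶠ k in atTop, j k ∈ Λ k) →
          Tendsto (fun k => expectation h (ψ k (j k))) atTop (𝓝 (∫ z in (0 : ℝ)..1, h z))) := by
  have hne := eventually_bin_nonempty hS hn hK hU hψ hI hlen
  refine ⟨hne, fun h ⟨C, hC⟩ => tendsto_bin_average hS herg hn hK hU hψ hI hlen hC, ?_⟩
  have hbound : ∀ (d k : ℕ) (j : Fin (n k)), ‖expectation (fun z : ℝ => (z : ℂ) ^ d) (ψ k j) -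
      ∫ z in (0 : ℝ)..1, (z : ℂ) ^ d‖ ^ 2 ≤ 4 := by
    intro d k j
    have h1 : ∀ z ∈ Icc (0 : ℝ) 1, ‖(z : ℂ) ^ d‖ ≤ 1 := fun z hz => by
      rw [norm_pow, Complex.norm_real, Real.norm_of_nonneg hz.1]
      exact pow_le_one₀ hz.1 hz.2
    have h2 := norm_expectation_le ((ψ k).norm_eq_one j)
      (continuous_monomial d).continuousOn.integrableOn_Icc h1
    have h3 : ‖∫ z in (0 : ℝ)..1, (z : ℂ) ^ d‖ ≤ 1 := by
      have := intervalIntegral.norm_integral_le_of_norm_le_const (a := 0) (b := 1) (C := 1)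
        (f := fun z : ℝ => (z : ℂ) ^ d) fun z hz => h1 z (by
          rw [uIoc_of_le zero_le_one] at hz; exact Ioc_subset_Icc_self hz)
      simpa using this
    have h4 := norm_sub_le (expectation (fun z : ℝ => (z : ℂ) ^ d) (ψ k j))
      (∫ z in (0 : ℝ)..1, (z : ℂ) ^ d)
    calc _ ≤ (2 : ℝ) ^ 2 := by gcongr; linarith
      _ = 4 := by norm_num
  obtain ⟨Λ, hΛ1, hΛ2, hΛ3⟩ := exists_full_density_subsets (fun k => bin (θ k) (I k)) hne
    (fun d k j => ‖expectation (fun z : ℝ => (z : ℂ) ^ d) (ψ k j) -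
      ∫ z in (0 : ℝ)..1, (z : ℂ) ^ d‖ ^ 2) (fun d k j => by positivity) hbound fun d => by
      obtain ⟨C, hC⟩ := exists_lipschitzOnWith_monomial d
      exact tendsto_bin_average hS herg hn hK hU hψ hI hlen hC
  refine ⟨Λ, hΛ1, hΛ2, fun h hh j hj => ?_⟩
  refine tendsto_expectation_of_monomials (fun k => (ψ k).norm_eq_one (j k)) (fun d => ?_) hh
  rw [tendsto_iff_norm_sub_tendsto_zero]
  have := (hΛ3 d j hj).sqrt
  simpa [Real.sqrt_sq (norm_nonneg _)] using this
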